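/- Theorem 1.2. Let $\mu$ be a probability measure on $\mathbb{C}$, and let $(a_i)_{i\ge 1}$ and $(b_i)_{i\ge 1}$ be sequences of complex numbers such that: (i) both sequences are $\mu$-distributed, i.e. the measures $\frac1n\sum_{i=1}^n\delta_{a_i}$ and $\frac1n\sum_{i=1}^n\delta_{b_i}$ converge weakly to $\mu$ as $n\to\infty$; (ii) both sequences are log-Cesàro bounded, i.e. the sequences $\big(\frac1n\sum_{i=1}^n\log_+|a_i|\big)_{n\ge1}$ and $\big(\frac1n\sum_{i=1}^n\log_+|b_i|\big)_{n\ge1}$ are bounded, where $\log_+x=\max(\log x,0)$ for $x>0$ and $\log_+0=0$; (iii) $a_i\ne b_i$ for infinitely many $i$. Let $(\xi_i)_{i\ge1}$ be independent complex random variables on a probability space such that $\xi_i$ has law $\frac12\delta_{a_i}+\frac12\delta_{b_i}$ for each $i$, and let $P_n(z)=(z-\xi_1)\cdots(z-\xi_n)$. For a complex polynomial $Q$ of positive degree, let $\mathcal M(Q)$ be the uniform probability measure on the multiset of its zeros, i.e. $\mathcal M(Q)=\frac1{\deg Q}\sum_{w}\delta_w$, the sum being over the zeros $w$ of $Q$ counted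 with multiplicity. Then, almost surely, $\mathcal M(P_n)\to\mu$ weakly as $n\to\infty$. Moreover, for every integer $k\ge1$, $\mathcal M(P_n^{(k)})\to\mu$ in probability as $n\to\infty$ (over $n>k$) with respect to the topology of weak convergence: for every neighbourhood $U$ of $\mu$ in the space of probability measures on $\mathbb C$ with the weak topology, $\mathbf P\big(\mathcal M(P_n^{(k)})\notin U\big)\to0$. -/

import Mathlib

open MeasureTheory ProbabilityTheory Filter Topology Polynomial
open scoped ENNReal

noncomputable section

/-- The measure `(1 / #s) ∑_{w ∈ s} δ_w` attached to a finite multiset `s` of complex numbers,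
each point being counted with its multiplicity. -/
def empiricalMeasureAux (s : Multiset ℂ) : Measure ℂ :=
  (Multiset.card s : ℝ≥0∞)⁻¹ • (s.map fun w => Measure.dirac w).sum

theorem sum_dirac_univ (s : Multiset ℂ) :
    (s.map fun w => Measure.dirac w).sum Set.univ = (Multiset.card s : ℝ≥0∞) := by
  induction s using Multiset.induction_on with
  | empty => simp
  | cons a s ih => simp [ih, add_comm]

theorem isProbabilityMeasure_empiricalMeasureAux {s : Multiset ℂ} (hs : s ≠ 0) :
    IsProbabilityMeasure (empiricalMeasureAux s) := by
  refine ⟨?_⟩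
  rw [empiricalMeasureAux, Measure.smul_apply, sum_dirac_univ, smul_eq_mul]
  refine ENNReal.inv_mul_cancel ?_ (ENNReal.natCast_ne_top _)
  simpa using hs

open Classical in
/-- The uniform probability measure on a nonempty finite multiset of complex numbers. There is no
such measure on the empty multiset, for which the value `δ_0` is a placeholder. -/
def empiricalMeasure (s : Multiset ℂ) : ProbabilityMeasure ℂ :=
  if hs : s ≠ 0 then ⟨empiricalMeasureAux s, isProbabilityMeasure_empiricalMeasureAux hs⟩
  else ⟨Measure.dirac 0, inferInstance⟩

theorem coe_empiricalMeasure {s : Multiset ℂ} (hs : s ≠ 0) :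
    (empiricalMeasure s : Measure ℂ) = empiricalMeasureAux s := by
  have h : empiricalMeasure s =
      ⟨empiricalMeasureAux s, isProbabilityMeasure_empiricalMeasureAux hs⟩ := dif_pos hs
  rw [h]
  rfl

/-- `𝓜(P)`: the uniform probability measure on the multiset of complex zeros of `P`
(meaningful as soon as `P` has positive degree). -/
def zeroMeasure (P : ℂ[X]) : ProbabilityMeasure ℂ :=
  empiricalMeasure P.roots

/-- The sequence `a 0, a 1, …` is `μ`-distributed: the empirical measures of its first `n` terms
converge weakly to `μ`. -/
def IsDistributed (μ : ProbabilityMeasure ℂ) (a : ℕ → ℂ) : Prop :=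
  Tendsto (fun n : ℕ => empiricalMeasure ((Multiset.range n).map a)) atTop (𝓝 μ)

/-- The Cesàro means of `log₊ |a i|` are bounded. -/
def LogCesaroBounded (a : ℕ → ℂ) : Prop :=
  ∃ C : ℝ, ∀ n : ℕ, 1 ≤ n → (1 / (n : ℝ)) * ∑ i ∈ Finset.range n, Real.posLog ‖a i‖ ≤ C

/-- Convergence in probability of random probability measures on `ℂ` to a deterministic one, for
the topology of weak convergence: each neighbourhood of the limit is left with probability
tending to zero. -/
def TendstoInProbability {Ω : Type*} [MeasurableSpace Ω] (P : Measure Ω)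
    (M : ℕ → Ω → ProbabilityMeasure ℂ) (μ : ProbabilityMeasure ℂ) : Prop :=
  ∀ U ∈ 𝓝 μ, Tendsto (fun n : ℕ => P {ω | M n ω ∉ U}) atTop (𝓝 0)

/-- The monic polynomial `(z - x 0) ⋯ (z - x (n - 1))`. -/
def monicWithZeros (x : ℕ → ℂ) (n : ℕ) : ℂ[X] :=
  ∏ i ∈ Finset.range n, (X - C (x i))

end

/-! Let `p` be the monic polynomial with zeros `x i`. The proof compares logarithmic potentials. Off
the zeros, `p⁽ᵏ⁾ / (k! p)` at `z` is the `k`-th elementary symmetric function of the numbers `1 / (z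
- x i)`, which is `ratioCoeff`. If `(1/n) log` of its modulus is small in mean on circles, then `p`
and `p⁽ᵏ⁾` have nearly the same potential, hence nearly the same distribution of zeros. By Jensen's
formula, subtracting circle averages of `log ‖z - w‖` for radii `2 * s` and `s` leaves exactly `tent
s (w - c)`, so the comparison becomes one of integrals of tents (`abs_integral_tent_sub_le`). Tents
with centres in a countable dense set and radii `1 / (j + 1)` determine weak convergence to a
probability measure.

For `P_n` itself, the strong law on these countably many tents suffices. For derivatives, the mean
of `|logRatio|` on a circle tends to zero (`tendsto_lintegral_logRatio`) because of three estimates.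
Small values: `ratioCoeff` is unlikely to be below `exp (-ε n)` at any fixed `z`. This is a
Littlewood–Offord argument: Sperner's theorem, with induction on `k`, applied to finitely many
indices with `a i ≠ b i` while all other variables are frozen (`exists_card_choiceProd_le`,
`tendsto_measure_ratioCoeff_le`). Large values: `ratioCoeff` exceeds `exp (ε n)` only on a small
part of the circle, by Markov's inequality and a bound for the integral of `‖z - w‖ ^ (-1/2)`
uniform in `w` (`measure_exp_le_ratioCoeff`). Uniform integrability: an `L²` bound on `logRatio`,
where log-Cesàro boundedness enters; Mahler measure carries that hypothesis over to the zeros of the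
derivative (`lintegral_logRatio_sq_le`). -/

/-! ### Tents as test functions for weak convergence -/

/-- A compactly supported continuous bump, the difference of the averages of `log ‖z - v‖` over the
circles of radii `2 * s` and `s` centred at the origin. -/
noncomputable def tent (s : ℝ) (v : ℂ) : ℝ := Real.log (max (2 * s) ‖v‖) - Real.log (max s ‖v‖)

theorem tent_nonneg {s : ℝ} (hs : 0 < s) (v : ℂ) : 0 ≤ tent s v := by
  have h : max s ‖v‖ ≤ max (2 * s) ‖v‖ := max_le_max (by linarith) le_rfl
  exact sub_nonneg.2 (Real.log_le_log (lt_max_of_lt_left hs) h)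

theorem tent_le {s : ℝ} (hs : 0 < s) (v : ℂ) : tent s v ≤ Real.log 2 := by
  have h : max (2 * s) ‖v‖ ≤ 2 * max s ‖v‖ := by
    refine max_le ?_ ?_
    · linarith [le_max_left s ‖v‖]
    · linarith [le_max_right s ‖v‖, norm_nonneg v]
  have h0 : 0 < max s ‖v‖ := lt_max_of_lt_left hs
  have h1 := Real.log_le_log (lt_max_of_lt_left (by linarith)) h
  rw [Real.log_mul two_ne_zero h0.ne'] at h1
  rw [tent]
  linarith

theorem norm_tent_le {s : ℝ} (hs : 0 < s) (v : ℂ) : ‖tent s v‖ ≤ Real.log 2 := by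
  rw [Real.norm_of_nonneg (tent_nonneg hs v)]
  exact tent_le hs v

theorem tent_eq_zero {s : ℝ} (hs : 0 < s) {v : ℂ} (hv : 2 * s ≤ ‖v‖) : tent s v = 0 := by
  rw [tent, max_eq_right hv, max_eq_right (by linarith), sub_self]

theorem continuous_tent {s : ℝ} (hs : 0 < s) : Continuous (tent s) := by
  unfold tent
  refine Continuous.sub ?_ ?_
  · exact (continuous_const.max continuous_norm).log fun v => (lt_max_of_lt_left (by linarith)).ne'
  · exact (continuous_const.max continuous_norm).log fun v => (lt_max_of_lt_left hs).ne'

theorem hasCompactSupport_tent {s : ℝ} (hs : 0 < s) : HasCompactSupport (tent s) := by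
  refine HasCompactSupport.intro (isCompact_closedBall (0 : ℂ) (2 * s)) fun v hv => ?_
  refine tent_eq_zero hs ?_
  simpa using (not_le.1 (by simpa using hv)).le

theorem integral_tent_pos {s : ℝ} (hs : 0 < s) : 0 < ∫ v, tent s v := by
  refine (continuous_tent hs).integral_pos_of_hasCompactSupport_nonneg_nonzero (x := 0)
    (hasCompactSupport_tent hs) (tent_nonneg hs) ?_
  rw [tent, norm_zero, max_eq_left hs.le, max_eq_left (by linarith), Real.log_mul two_ne_zero hs.ne',
    add_sub_cancel_right]
  exact (Real.log_pos one_lt_two).ne'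

theorem integrable_tent {s : ℝ} (hs : 0 < s) : Integrable (tent s) :=
  (continuous_tent hs).integrable_of_hasCompactSupport (hasCompactSupport_tent hs)

theorem integrable_tent_sub (ν : Measure ℂ) [IsFiniteMeasure ν] {s : ℝ} (hs : 0 < s) (c : ℂ) :
    Integrable (fun w => tent s (w - c)) ν :=
  Integrable.of_bound
    ((continuous_tent hs).comp (continuous_sub_right c)).aestronglyMeasurable (Real.log 2)
    (ae_of_all _ fun w => norm_tent_le hs (w - c))

theorem tendsto_of_forall_approx {ι : Type*} {L : Filter ι} {u : ι → ℝ} {a : ℝ}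
    (h : ∀ ε > 0, ∃ (v : ι → ℝ) (b : ℝ), Tendsto v L (𝓝 b) ∧ (∀ i, |u i - v i| ≤ ε) ∧
      |a - b| ≤ ε) : Tendsto u L (𝓝 a) := by
  rw [Metric.tendsto_nhds]
  intro ε hε
  obtain ⟨v, b, hv, huv, hab⟩ := h (ε / 4) (by linarith)
  filter_upwards [Metric.tendsto_nhds.1 hv (ε / 4) (by linarith)] with i hi
  rw [Real.dist_eq] at hi ⊢
  have h1 := huv i
  rw [abs_le] at h1 hab
  rw [abs_lt] at hi ⊢
  constructor <;> linarith [h1.1, h1.2, hab.1, hab.2, hi.1, hi.2]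

theorem abs_integral_sub_le {ν : Measure ℂ} [IsProbabilityMeasure ν] {f g : ℂ → ℝ} {ε : ℝ}
    (hf : Integrable f ν) (hg : Integrable g ν) (h : ∀ w, |f w - g w| ≤ ε) :
    |∫ w, f w ∂ν - ∫ w, g w ∂ν| ≤ ε := by
  rw [← integral_sub hf hg]
  have := norm_integral_le_of_norm_le_const (μ := ν) (f := fun w => f w - g w) (C := ε)
    (ae_of_all _ h)
  simpa using this

/-- The kernel has the same mass about every `w` and vanishes at distance `2 * s` or more, so only
values of `f` close to `w` enter the average. -/
theorem abs_mollify_sub_le {f : ℂ → ℝ} (hf : Continuous f) (hfc : HasCompactSupport f) {s ε : ℝ}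
    (hs : 0 < s) (hmod : ∀ c w : ℂ, ‖w - c‖ < 2 * s → |f c - f w| ≤ ε) (w : ℂ) :
    |(∫ c, f c * tent s (w - c)) - (∫ v, tent s v) * f w| ≤ ε * ∫ v, tent s v := by
  have h1 : Integrable (fun c => tent s (w - c)) := (integrable_tent hs).comp_sub_left w
  have h2 : Integrable (fun c => f c * tent s (w - c)) :=
    ((hf.integrable_of_hasCompactSupport hfc).mul_bdd (c := Real.log 2)
      ((continuous_tent hs).comp (continuous_sub_left w)).aestronglyMeasurable
      (ae_of_all _ fun c => norm_tent_le hs (w - c)))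
  have e1 : ∫ v, tent s v = ∫ c, tent s (w - c) :=
    (integral_sub_left_eq_self (tent s) volume w).symm
  rw [e1, ← integral_mul_const, ← integral_const_mul, ← integral_sub h2 (h1.mul_const _)]
  rw [← Real.norm_eq_abs]
  refine norm_integral_le_of_norm_le (h1.const_mul ε) (ae_of_all _ fun c => ?_)
  have e2 : f c * tent s (w - c) - tent s (w - c) * f w = (f c - f w) * tent s (w - c) := by ring
  rw [e2, norm_mul, Real.norm_of_nonneg (tent_nonneg hs _), Real.norm_eq_abs]
  rcases lt_or_ge ‖w - c‖ (2 * s) with h | h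
  · exact mul_le_mul_of_nonneg_right (hmod c w h) (tent_nonneg hs _)
  · simp [tent_eq_zero hs h]

theorem integral_mollify (ν : Measure ℂ) [IsFiniteMeasure ν] {f : ℂ → ℝ} (hf : Continuous f)
    (hfc : HasCompactSupport f) {s : ℝ} (hs : 0 < s) :
    Integrable (fun w => ∫ c, f c * tent s (w - c)) ν ∧
      ∫ w, (∫ c, f c * tent s (w - c)) ∂ν = ∫ c, f c * ∫ w, tent s (w - c) ∂ν := by
  have h : Integrable (Function.uncurry fun w c => f c * tent s (w - c)) (ν.prod volume) := by
    refine ((hf.integrable_of_hasCompactSupport hfc).comp_snd ν).mul_bdd (c := Real.log 2)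
      ?_ (ae_of_all _ fun p => norm_tent_le hs (p.1 - p.2))
    exact ((continuous_tent hs).comp (continuous_fst.sub continuous_snd)).aestronglyMeasurable
  refine ⟨h.integral_prod_left, ?_⟩
  rw [integral_integral_swap h]
  simp_rw [integral_const_mul]

/-- Normalised convolution with a narrow tent approximates `f` uniformly, with an error independent
of the measure. By Fubini the integral of the convolution is an average over centres `c` of tent
integrals, and dominated convergence in `c` applies. -/
theorem tendsto_integral_of_tendsto_tent {ι : Type*} {L : Filter ι} [L.IsCountablyGenerated]
    {ν : ι → ProbabilityMeasure ℂ} {μ : ProbabilityMeasure ℂ}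
    (h : ∀ (c : ℂ) (j : ℕ), Tendsto (fun i => ∫ w, tent (1 / (j + 1 : ℝ)) (w - c) ∂(ν i : Measure ℂ))
      L (𝓝 (∫ w, tent (1 / (j + 1 : ℝ)) (w - c) ∂(μ : Measure ℂ))))
    {f : ℂ → ℝ} (hf : Continuous f) (hfc : HasCompactSupport f) :
    Tendsto (fun i => ∫ w, f w ∂(ν i : Measure ℂ)) L (𝓝 (∫ w, f w ∂(μ : Measure ℂ))) := by
  refine tendsto_of_forall_approx fun ε hε => ?_
  obtain ⟨δ, hδ, hmod⟩ := Metric.uniformContinuous_iff.1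
    (hfc.uniformContinuous_of_continuous hf) ε hε
  obtain ⟨j, hj⟩ := exists_nat_one_div_lt (show 0 < δ / 2 by linarith)
  set s : ℝ := 1 / (j + 1 : ℝ) with hsdef
  have hs : 0 < s := by positivity
  set κ := ∫ v, tent s v with hκdef
  have hκ : 0 < κ := integral_tent_pos hs
  have hfint : ∀ ρ : ProbabilityMeasure ℂ, Integrable f (ρ : Measure ℂ) := fun ρ =>
    hf.integrable_of_hasCompactSupport hfc
  have key : ∀ ρ : ProbabilityMeasure ℂ,
      |∫ w, f w ∂(ρ : Measure ℂ) - κ⁻¹ * ∫ c, f c * ∫ w, tent s (w - c) ∂(ρ : Measure ℂ)| ≤ ε := by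
    intro ρ
    obtain ⟨h1, h2⟩ := integral_mollify (ρ : Measure ℂ) hf hfc hs
    rw [← h2, ← integral_const_mul]
    refine abs_integral_sub_le (hfint ρ) (h1.const_mul _) fun w => ?_
    have h3 := abs_mollify_sub_le (ε := ε) hf hfc hs (fun c w hcw => by
      have := hmod (a := c) (b := w) (by rw [dist_comm, dist_eq_norm]; linarith)
      rw [Real.dist_eq] at this
      exact this.le) w
    rw [abs_sub_comm]
    have e : κ⁻¹ * (∫ c, f c * tent s (w - c)) - f w =
        κ⁻¹ * ((∫ c, f c * tent s (w - c)) - κ * f w) := by field_simp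
    rw [e, abs_mul, abs_of_pos (inv_pos.2 hκ), inv_mul_le_iff₀ hκ, mul_comm κ ε]
    exact h3
  refine ⟨_, _, ?_, fun i => key (ν i), key μ⟩
  refine Tendsto.const_mul _ ?_
  refine tendsto_integral_filter_of_dominated_convergence (fun c => ‖f c‖ * Real.log 2)
    (Eventually.of_forall fun i => ?_) (Eventually.of_forall fun i => ae_of_all _ fun c => ?_)
    ((hf.integrable_of_hasCompactSupport hfc).norm.mul_const _)
    (ae_of_all _ fun c => (h c j).const_mul _)
  · refine hf.aestronglyMeasurable.mul ?_
    have : StronglyMeasurable (Function.uncurry fun c w : ℂ => tent s (w - c)) :=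
      ((continuous_tent hs).comp (continuous_snd.sub continuous_fst)).stronglyMeasurable
    exact this.integral_prod_right.aestronglyMeasurable
  · rw [norm_mul]
    refine mul_le_mul_of_nonneg_left ?_ (norm_nonneg _)
    simpa using norm_integral_le_of_norm_le_const (μ := (ν i : Measure ℂ))
      (ae_of_all _ fun w => norm_tent_le hs (w - c))

/-- Vague convergence is weak convergence when the limit is a probability measure: inner regularity
puts almost all the limit mass of an open set on a compact subset, and a Urysohn function between
the two gives the lower bound of the portmanteau theorem. -/
theorem tendsto_of_tendsto_integral_compactSupport {ι : Type*} {L : Filter ι}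
    [L.IsCountablyGenerated] {ν : ι → ProbabilityMeasure ℂ} {μ : ProbabilityMeasure ℂ}
    (h : ∀ f : ℂ → ℝ, Continuous f → HasCompactSupport f →
      Tendsto (fun i => ∫ w, f w ∂(ν i : Measure ℂ)) L (𝓝 (∫ w, f w ∂(μ : Measure ℂ)))) :
    Tendsto ν L (𝓝 μ) := by
  refine tendsto_of_forall_isOpen_le_liminf' fun G hG => ?_
  refine le_of_forall_lt fun r hr => ?_
  obtain ⟨r', hrr', hr'⟩ := exists_between hr
  refine hrr'.trans_le ?_
  obtain ⟨K, hKG, hK, hKr⟩ := hG.exists_lt_isCompact hr'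
  obtain ⟨f, hf1, hfc, hfG, hf01⟩ := exists_continuousMap_one_of_isCompact_subset_isOpen hK hG hKG
  have hint : ∀ ρ : ProbabilityMeasure ℂ, Integrable f (ρ : Measure ℂ) := fun ρ =>
    f.continuous.integrable_of_hasCompactSupport hfc
  have upper : ∀ ρ : ProbabilityMeasure ℂ,
      ENNReal.ofReal (∫ w, f w ∂(ρ : Measure ℂ)) ≤ (ρ : Measure ℂ) G := by
    intro ρ
    have h1 : ∫ w, f w ∂(ρ : Measure ℂ) ≤ ∫ w, G.indicator (fun _ => (1 : ℝ)) w ∂(ρ : Measure ℂ) := by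
      refine integral_mono (hint ρ) ((integrable_const _).indicator hG.measurableSet) fun w => ?_
      by_cases hw : w ∈ G
      · simpa [hw] using (hf01 w).2
      · simp [hw, image_eq_zero_of_notMem_tsupport fun h => hw (hfG h)]
    rw [integral_indicator_const _ hG.measurableSet, smul_eq_mul, mul_one] at h1
    exact ENNReal.ofReal_le_of_le_toReal h1
  have lower : (μ : Measure ℂ) K ≤ ENNReal.ofReal (∫ w, f w ∂(μ : Measure ℂ)) := by
    have h1 : ∫ w, K.indicator (fun _ => (1 : ℝ)) w ∂(μ : Measure ℂ) ≤ ∫ w, f w ∂(μ : Measure ℂ) := by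
      refine integral_mono ((integrable_const _).indicator hK.measurableSet) (hint μ) fun w => ?_
      by_cases hw : w ∈ K
      · simp [hw, hf1 hw]
      · simpa [hw] using (hf01 w).1
    rw [integral_indicator_const _ hK.measurableSet, smul_eq_mul, mul_one] at h1
    rw [← ENNReal.ofReal_toReal (measure_ne_top (μ : Measure ℂ) K)]
    exact ENNReal.ofReal_le_ofReal h1
  have hlim := ENNReal.tendsto_ofReal (h f f.continuous hfc)
  refine le_liminf_of_le (by isBoundedDefault) ?_
  filter_upwards [hlim.eventually_const_lt (hKr.trans_le lower)] with i hi
  exact hi.le.trans (upper (ν i))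

theorem tendsto_of_tendsto_tent_denseSeq {ι : Type*} {L : Filter ι} [L.IsCountablyGenerated]
    {ν : ι → ProbabilityMeasure ℂ} {μ : ProbabilityMeasure ℂ}
    (h : ∀ m j : ℕ, Tendsto
      (fun i => ∫ w, tent (1 / (j + 1 : ℝ)) (w - TopologicalSpace.denseSeq ℂ m) ∂(ν i : Measure ℂ))
      L (𝓝 (∫ w, tent (1 / (j + 1 : ℝ)) (w - TopologicalSpace.denseSeq ℂ m) ∂(μ : Measure ℂ)))) :
    Tendsto ν L (𝓝 μ) := by
  refine tendsto_of_tendsto_integral_compactSupport fun f hf hfc =>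
    tendsto_integral_of_tendsto_tent (fun c j => ?_) hf hfc
  refine tendsto_of_forall_approx fun ε hε => ?_
  have hs : (0 : ℝ) < 1 / (j + 1 : ℝ) := by positivity
  obtain ⟨δ, hδ, hmod⟩ := Metric.uniformContinuous_iff.1
    ((hasCompactSupport_tent hs).uniformContinuous_of_continuous (continuous_tent hs)) ε hε
  obtain ⟨m, hm⟩ := (TopologicalSpace.denseRange_denseSeq ℂ).exists_dist_lt c hδ
  have key : ∀ ρ : ProbabilityMeasure ℂ, |∫ w, tent (1 / (j + 1 : ℝ)) (w - c) ∂(ρ : Measure ℂ) -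
      ∫ w, tent (1 / (j + 1 : ℝ)) (w - TopologicalSpace.denseSeq ℂ m) ∂(ρ : Measure ℂ)| ≤ ε := by
    intro ρ
    refine abs_integral_sub_le (integrable_tent_sub _ hs _) (integrable_tent_sub _ hs _) fun w => ?_
    have := hmod (a := w - c) (b := w - TopologicalSpace.denseSeq ℂ m)
      (by rwa [dist_sub_left])
    rw [Real.dist_eq] at this
    exact this.le
  exact ⟨_, _, h m j, fun i => key (ν i), key μ⟩

/-- Every neighbourhood of `μ` in the weak topology contains one defined by finitely many tents. -/
theorem iInf_comap_tent_le_nhds (μ : ProbabilityMeasure ℂ) :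
    (⨅ p : ℕ × ℕ, comap (fun ρ : ProbabilityMeasure ℂ =>
      ∫ w, tent (1 / (p.2 + 1 : ℝ)) (w - TopologicalSpace.denseSeq ℂ p.1) ∂(ρ : Measure ℂ))
      (𝓝 (∫ w, tent (1 / (p.2 + 1 : ℝ)) (w - TopologicalSpace.denseSeq ℂ p.1) ∂(μ : Measure ℂ))))
      ≤ 𝓝 μ := by
  -- The criterion is applied to the identity map along the infimum filter itself, which is
  -- countably generated because the family of tents is countable.
  refine tendsto_id'.1 (tendsto_of_tendsto_tent_denseSeq fun m j => ?_)
  exact tendsto_comap.mono_left (iInf_le _ (m, j))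

/-- Convergence in probability of random measures can be tested on tents. -/
theorem tendstoInProbability_of_tent {Ω : Type*} [MeasurableSpace Ω] {P : Measure Ω}
    {M : ℕ → Ω → ProbabilityMeasure ℂ} {μ : ProbabilityMeasure ℂ}
    (h : ∀ (c : ℂ) (s : ℝ), 0 < s → ∀ ε > 0, Tendsto (fun n => P {ω | ε ≤
      |∫ w, tent s (w - c) ∂(M n ω : Measure ℂ) - ∫ w, tent s (w - c) ∂(μ : Measure ℂ)|})
      atTop (𝓝 0)) :
    TendstoInProbability P M μ := by
  intro U hU
  have hU' := iInf_comap_tent_le_nhds μ hU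
  clear hU
  set T : ℕ × ℕ → ProbabilityMeasure ℂ → ℝ := fun p ρ =>
    ∫ w, tent (1 / (p.2 + 1 : ℝ)) (w - TopologicalSpace.denseSeq ℂ p.1) ∂(ρ : Measure ℂ) with hT
  -- A set in the infimum filter is reached by finitely many intersections, each costing one union
  -- bound.
  refine iInf_sets_induct (p := fun U => Tendsto (fun n => P {ω | M n ω ∉ U}) atTop (𝓝 0)) hU'
    (by simp) ?_
  · intro p s₁ s₂ h₁ ih
    obtain ⟨V, hV, hVs⟩ := h₁
    obtain ⟨ε, hε, hball⟩ := Metric.mem_nhds_iff.1 hV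
    have h3 := (h (TopologicalSpace.denseSeq ℂ p.1) (1 / (p.2 + 1 : ℝ)) (by positivity) ε hε).add ih
    rw [add_zero] at h3
    refine tendsto_of_tendsto_of_tendsto_of_le_of_le tendsto_const_nhds h3 (fun _ => zero_le)
      fun n => ?_
    refine (measure_mono fun ω hω => ?_).trans (measure_union_le _ _)
    by_contra hcon
    rw [Set.mem_union, not_or] at hcon
    refine hω ⟨hVs (hball ?_), not_not.1 hcon.2⟩
    rw [Metric.mem_ball, Real.dist_eq]
    exact not_le.1 hcon.1

/-! ### Law of large numbers and the zeros of the polynomial itself -/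

/-- Strong law of large numbers for bounded independent variables. -/
theorem ae_tendsto_average_sub_integral {Ω : Type*} [MeasurableSpace Ω] {P : Measure Ω}
    [IsProbabilityMeasure P] {X : ℕ → Ω → ℝ} {M : ℝ} (hX : ∀ i, Measurable (X i))
    (hM : ∀ i ω, X i ω ∈ Set.Icc 0 M) (hind : iIndepFun X P) :
    ∀ᵐ ω ∂P, Tendsto (fun n : ℕ => (1 / (n : ℝ)) * ∑ i ∈ Finset.range n, (X i ω - ∫ ω, X i ω ∂P))
      atTop (𝓝 0) := by
  have hsub : ∀ i, HasSubgaussianMGF (fun ω => X i ω - ∫ ω, X i ω ∂P) ((‖M - 0‖₊ / 2) ^ 2) P :=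
    fun i => hasSubgaussianMGF_of_mem_Icc (hX i).aemeasurable (ae_of_all _ (hM i))
  have hind' : iIndepFun (fun i ω => X i ω - ∫ ω, X i ω ∂P) P :=
    hind.comp (fun i x => x - ∫ ω, X i ω ∂P) fun i => measurable_id.sub_const _
  have hindneg : iIndepFun (fun i ω => -(X i ω - ∫ ω, X i ω ∂P)) P :=
    hind'.comp (fun i x => -x) fun i => measurable_neg
  set Y : ℕ → Ω → ℝ := fun i ω => X i ω - ∫ ω, X i ω ∂P with hY
  -- The added `1` keeps the variance proxy positive when `M = 0`, so that the ratio `q` below is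
  -- less than `1`.
  set c : NNReal := (‖M - 0‖₊ / 2) ^ 2 + 1 with hc
  have hcpos : (0 : ℝ) < c := by positivity
  have hsub' : ∀ i, HasSubgaussianMGF (Y i) c P := fun i =>
    ⟨(hsub i).integrable_exp_mul, fun t => ((hsub i).mgf_le t).trans (by
      gcongr
      exact le_add_of_nonneg_right zero_le_one)⟩
  have main : ∀ j : ℕ, ∀ᵐ ω ∂P, ∀ᶠ n : ℕ in atTop,
      |∑ i ∈ Finset.range n, Y i ω| < 1 / (j + 1 : ℝ) * n := by
    intro j
    set ε : ℝ := 1 / (j + 1 : ℝ) with hε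
    have hεpos : 0 < ε := by positivity
    set q : ℝ := Real.exp (-ε ^ 2 / (2 * c)) with hq
    have hq1 : q < 1 := Real.exp_lt_one_iff.2 (by
      rw [neg_div]
      exact neg_neg_of_pos (by positivity))
    have hq0 : 0 ≤ q := (Real.exp_pos _).le
    -- Hoeffding's inequality at deviation `ε * n` decays geometrically, so Borel–Cantelli applies
    -- to `Y` and to `-Y`.
    have bound : ∀ (Z : ℕ → Ω → ℝ), iIndepFun Z P → (∀ i, HasSubgaussianMGF (Z i) c P) →
        ∀ n : ℕ, P {ω | ε * n ≤ ∑ i ∈ Finset.range n, Z i ω} ≤ ENNReal.ofReal (q ^ n) := by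
      intro Z hZ hZs n
      rcases Nat.eq_zero_or_pos n with rfl | hn
      · simp
      have h1 := HasSubgaussianMGF.measure_sum_range_ge_le_of_iIndepFun hZ (n := n)
        (fun i _ => hZs i) (ε := ε * n) (by positivity)
      have hn' : (n : ℝ) ≠ 0 := by exact_mod_cast hn.ne'
      have e : Real.exp (-(ε * n) ^ 2 / (2 * n * c)) = q ^ n := by
        rw [hq, ← Real.exp_nat_mul]
        congr 1
        field_simp
      rw [e] at h1
      rw [← ENNReal.ofReal_toReal (measure_ne_top P {ω | ε * n ≤ ∑ i ∈ Finset.range n, Z i ω})]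
      exact ENNReal.ofReal_le_ofReal h1
    have hsum : ∀ (Z : ℕ → Ω → ℝ), iIndepFun Z P → (∀ i, HasSubgaussianMGF (Z i) c P) →
        ∀ᵐ ω ∂P, ∀ᶠ n : ℕ in atTop, ∑ i ∈ Finset.range n, Z i ω < ε * n := by
      intro Z hZ hZs
      have h2 : ∑' n, P {ω | ε * n ≤ ∑ i ∈ Finset.range n, Z i ω} ≠ ∞ := by
        refine ne_top_of_le_ne_top ?_ (ENNReal.tsum_le_tsum (bound Z hZ hZs))
        rw [← ENNReal.ofReal_tsum_of_nonneg (fun n => pow_nonneg hq0 n)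
          (summable_geometric_of_lt_one hq0 hq1)]
        exact ENNReal.ofReal_ne_top
      filter_upwards [ae_eventually_notMem h2] with ω hω
      filter_upwards [hω] with n hn
      exact not_le.1 hn
    filter_upwards [hsum Y hind' hsub', hsum _ hindneg fun i => (hsub' i).neg] with ω h1 h2
    filter_upwards [h1, h2] with n h1 h2
    rw [Finset.sum_neg_distrib] at h2
    exact abs_lt.2 ⟨by linarith, h1⟩
  filter_upwards [ae_all_iff.2 main] with ω hω
  rw [Metric.tendsto_nhds]
  intro ε hε
  obtain ⟨j, hj⟩ := exists_nat_one_div_lt hε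
  filter_upwards [hω j, eventually_gt_atTop 0] with n hn hn0
  have hn' : (0 : ℝ) < n := by exact_mod_cast hn0
  rw [dist_zero_right, norm_mul, Real.norm_of_nonneg (by positivity), one_div,
    inv_mul_lt_iff₀ hn', Real.norm_eq_abs]
  nlinarith

theorem integral_empiricalMeasure {s : Multiset ℂ} (hs : s ≠ 0) (f : ℂ → ℝ) :
    ∫ w, f w ∂(empiricalMeasure s : Measure ℂ) = (1 / (Multiset.card s : ℝ)) * (s.map f).sum := by
  rw [coe_empiricalMeasure hs, empiricalMeasureAux, integral_smul_measure, ENNReal.toReal_inv,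
    ENNReal.toReal_natCast, one_div, smul_eq_mul]
  congr 1
  have : Integrable f (s.map fun w => Measure.dirac w).sum ∧
      ∫ w, f w ∂(s.map fun w => Measure.dirac w).sum = (s.map f).sum := by
    clear hs
    induction s using Multiset.induction_on with
    | empty => simp
    | cons a s ih =>
      have h : Integrable f (Measure.dirac a) := integrable_dirac (by simp)
      simp only [Multiset.map_cons, Multiset.sum_cons]
      exact ⟨h.add_measure ih.1, by rw [integral_add_measure h ih.1, integral_dirac, ih.2]⟩
  exact this.2

theorem integral_empiricalMeasure_range (x : ℕ → ℂ) {n : ℕ} (hn : 0 < n) (f : ℂ → ℝ) :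
    ∫ w, f w ∂(empiricalMeasure ((Multiset.range n).map x) : Measure ℂ) =
      (1 / (n : ℝ)) * ∑ i ∈ Finset.range n, f (x i) := by
  have hs : (Multiset.range n).map x ≠ 0 := by
    rw [← Multiset.card_pos]
    simpa using hn
  rw [integral_empiricalMeasure hs, Multiset.card_map, Multiset.card_range, Multiset.map_map]
  rfl

theorem monicWithZeros_ne_zero (x : ℕ → ℂ) (n : ℕ) : monicWithZeros x n ≠ 0 :=
  (monic_prod_of_monic _ _ fun i _ => monic_X_sub_C (x i)).ne_zero

theorem roots_monicWithZeros (x : ℕ → ℂ) (n : ℕ) :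
    (monicWithZeros x n).roots = (Multiset.range n).map x := by
  rw [monicWithZeros, roots_prod _ _ (monicWithZeros_ne_zero x n)]
  simp only [roots_X_sub_C, Multiset.bind_singleton]
  rfl

theorem natDegree_monicWithZeros (x : ℕ → ℂ) (n : ℕ) : (monicWithZeros x n).natDegree = n := by
  rw [monicWithZeros, natDegree_prod_of_monic _ _ fun i _ => monic_X_sub_C (x i)]
  simp

theorem IsDistributed.tendsto_average {μ : ProbabilityMeasure ℂ} {a : ℕ → ℂ}
    (ha : IsDistributed μ a) {f : ℂ → ℝ} (hf : Continuous f) {M : ℝ} (hM : ∀ w, ‖f w‖ ≤ M) :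
    Tendsto (fun n : ℕ => (1 / (n : ℝ)) * ∑ i ∈ Finset.range n, f (a i)) atTop
      (𝓝 (∫ w, f w ∂(μ : Measure ℂ))) := by
  have h := ProbabilityMeasure.tendsto_iff_forall_integral_tendsto.1 ha
    (BoundedContinuousFunction.ofNormedAddCommGroup f hf M hM)
  refine h.congr' ?_
  filter_upwards [eventually_gt_atTop 0] with n hn
  exact integral_empiricalMeasure_range a hn f

/-- The law of large numbers for a `μ`-distributed pair of sequences. -/
theorem ae_tendsto_average {Ω : Type*} [MeasurableSpace Ω] {P : Measure Ω} [IsProbabilityMeasure P]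
    {μ : ProbabilityMeasure ℂ} {a b : ℕ → ℂ} (ha : IsDistributed μ a) (hb : IsDistributed μ b)
    {ξ : ℕ → Ω → ℂ} (hξ_meas : ∀ i, Measurable (ξ i)) (hξ_indep : iIndepFun ξ P)
    (hξ_law : ∀ i, P.map (ξ i) =
      (2⁻¹ : ℝ≥0∞) • Measure.dirac (a i) + (2⁻¹ : ℝ≥0∞) • Measure.dirac (b i))
    {f : ℂ → ℝ} (hf : Continuous f) {M : ℝ} (hM : ∀ w, f w ∈ Set.Icc 0 M) :
    ∀ᵐ ω ∂P, Tendsto (fun n : ℕ => (1 / (n : ℝ)) * ∑ i ∈ Finset.range n, f (ξ i ω)) atTop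
      (𝓝 (∫ w, f w ∂(μ : Measure ℂ))) := by
  have hM' : ∀ w, ‖f w‖ ≤ M := fun w => by
    rw [Real.norm_of_nonneg (hM w).1]
    exact (hM w).2
  have hmean : ∀ i, ∫ ω, f (ξ i ω) ∂P = (f (a i) + f (b i)) / 2 := by
    intro i
    rw [← integral_map (hξ_meas i).aemeasurable hf.aestronglyMeasurable, hξ_law i,
      integral_add_measure ((integrable_dirac (by simp)).smul_measure (by simp))
        ((integrable_dirac (by simp)).smul_measure (by simp)), integral_smul_measure,
      integral_smul_measure, integral_dirac, integral_dirac]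
    simp
    ring
  have hlim := ((ha.tendsto_average hf hM').add (hb.tendsto_average hf hM')).div_const 2
  filter_upwards [ae_tendsto_average_sub_integral (P := P) (X := fun i ω => f (ξ i ω))
    (fun i => hf.measurable.comp (hξ_meas i)) (fun i ω => hM (ξ i ω))
    (hξ_indep.comp (fun _ => f) fun _ => hf.measurable)] with ω hω
  have h := hω.add hlim
  rw [zero_add, add_self_div_two] at h
  refine h.congr fun n => ?_
  simp only [hmean, Finset.sum_sub_distrib, ← Finset.sum_div, Finset.sum_add_distrib]
  ring

theorem ae_tendsto_zeroMeasure {Ω : Type*} [MeasurableSpace Ω] {P : Measure Ω}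
    [IsProbabilityMeasure P] {μ : ProbabilityMeasure ℂ} {a b : ℕ → ℂ} (ha : IsDistributed μ a)
    (hb : IsDistributed μ b) {ξ : ℕ → Ω → ℂ} (hξ_meas : ∀ i, Measurable (ξ i))
    (hξ_indep : iIndepFun ξ P)
    (hξ_law : ∀ i, P.map (ξ i) =
      (2⁻¹ : ℝ≥0∞) • Measure.dirac (a i) + (2⁻¹ : ℝ≥0∞) • Measure.dirac (b i)) :
    ∀ᵐ ω ∂P, Tendsto (fun n : ℕ => zeroMeasure (monicWithZeros (fun i => ξ i ω) n))
      atTop (𝓝 μ) := by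
  have h : ∀ m j : ℕ, ∀ᵐ ω ∂P, Tendsto (fun n : ℕ => (1 / (n : ℝ)) * ∑ i ∈ Finset.range n,
      tent (1 / (j + 1 : ℝ)) (ξ i ω - TopologicalSpace.denseSeq ℂ m)) atTop
      (𝓝 (∫ w, tent (1 / (j + 1 : ℝ)) (w - TopologicalSpace.denseSeq ℂ m) ∂(μ : Measure ℂ))) :=
    fun m j => ae_tendsto_average (M := Real.log 2)
      (f := fun w => tent (1 / (j + 1 : ℝ)) (w - TopologicalSpace.denseSeq ℂ m)) ha hb hξ_meas
      hξ_indep hξ_law ((continuous_tent (by positivity)).comp (continuous_sub_right _))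
      fun w => ⟨tent_nonneg (by positivity) _, tent_le (by positivity) _⟩
  filter_upwards [ae_all_iff.2 fun m => ae_all_iff.2 (h m)] with ω hω
  refine tendsto_of_tendsto_tent_denseSeq fun m j => (hω m j).congr' ?_
  filter_upwards [eventually_gt_atTop 0] with n hn
  rw [zeroMeasure, roots_monicWithZeros, integral_empiricalMeasure_range _ hn
    (fun w => tent (1 / (j + 1 : ℝ)) (w - TopologicalSpace.denseSeq ℂ m))]

/-! ### Sperner's theorem and anti-concentration of coefficients -/

/-- An elementary replacement for Stirling's formula: the central binomial coefficient is at most `4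
^ n / √(2n + 1)`. The induction reduces to `4 (2n + 3) (2n + 1) ≤ 16 (n + 1)²`. -/
theorem mul_centralBinom_sq_le (n : ℕ) : (2 * n + 1) * n.centralBinom ^ 2 ≤ 16 ^ n := by
  induction n with
  | zero => simp
  | succ n ih =>
    have h := Nat.succ_mul_centralBinom_succ n
    refine Nat.le_of_mul_le_mul_left ?_ (show 0 < (n + 1) ^ 2 by positivity)
    calc (n + 1) ^ 2 * ((2 * (n + 1) + 1) * (n + 1).centralBinom ^ 2)
        = (2 * n + 3) * ((n + 1) * (n + 1).centralBinom) ^ 2 := by ring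
      _ = (4 * (2 * n + 3) * (2 * n + 1)) * ((2 * n + 1) * n.centralBinom ^ 2) := by rw [h]; ring
      _ ≤ (16 * (n + 1) ^ 2) * 16 ^ n := Nat.mul_le_mul (by nlinarith) ih
      _ = (n + 1) ^ 2 * 16 ^ (n + 1) := by ring

theorem exists_antichain_card_le {η : ℝ} (hη : 0 < η) :
    ∃ m : ℕ, ∀ A : Finset (Finset (Fin m)), IsAntichain (· ⊆ ·) (A : Set (Finset (Fin m))) →
      (A.card : ℝ) ≤ η * 2 ^ m := by
  obtain ⟨n, hn⟩ := exists_nat_gt (1 / η ^ 2)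
  refine ⟨2 * n, fun A hA => ?_⟩
  have h1 := hA.sperner
  rw [Fintype.card_fin, Nat.mul_div_cancel_left n two_pos, ← Nat.centralBinom_eq_two_mul_choose] at h1
  have h2 : (2 * n + 1 : ℝ) * (n.centralBinom : ℝ) ^ 2 ≤ 16 ^ n := by
    exact_mod_cast mul_centralBinom_sq_le n
  have h3 : (A.card : ℝ) ≤ n.centralBinom := by exact_mod_cast h1
  refine h3.trans (abs_le_of_sq_le_sq' ?_ (by positivity)).2
  have e : (η * 2 ^ (2 * n)) ^ 2 = η ^ 2 * (16 : ℝ) ^ n := by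
    rw [mul_pow, ← pow_mul, show 2 * n * 2 = 4 * n by ring, pow_mul]
    norm_num
  rw [e]
  have h4 : 1 ≤ η ^ 2 * (2 * n + 1) := by
    rw [div_lt_iff₀ (by positivity)] at hn
    nlinarith [sq_nonneg η, sq_nonneg η]
  have h5 : (0 : ℝ) ≤ (n.centralBinom : ℝ) ^ 2 := by positivity
  calc (n.centralBinom : ℝ) ^ 2 = 1 * (n.centralBinom : ℝ) ^ 2 := (one_mul _).symm
    _ ≤ (η ^ 2 * (2 * n + 1)) * (n.centralBinom : ℝ) ^ 2 := by gcongr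
    _ = η ^ 2 * ((2 * n + 1) * (n.centralBinom : ℝ) ^ 2) := by ring
    _ ≤ η ^ 2 * 16 ^ n := by gcongr

theorem coeff_zero_prod_one_add {ι : Type*} (s : Finset ι) (u : ι → ℂ) :
    (∏ i ∈ s, (1 + C (u i) * X)).coeff 0 = 1 := by
  simp [coeff_zero_prod]

theorem coeff_one_prod_one_add {ι : Type*} (s : Finset ι) (u : ι → ℂ) :
    (∏ i ∈ s, (1 + C (u i) * X)).coeff 1 = ∑ i ∈ s, u i := by
  classical
  induction s using Finset.induction_on with
  | empty => simp [coeff_one]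
  | insert a s ha ih =>
    rw [Finset.prod_insert ha, Finset.sum_insert ha, add_mul, one_mul, coeff_add, ih, mul_assoc,
      coeff_C_mul, coeff_X_mul, coeff_zero_prod_one_add]
    ring

open Classical in
/-- The linear factors with parameter `x i` for `i ∈ S` and `y i` for the other `i`. -/
noncomputable def choiceProd {α : Type*} [Fintype α] (x y : α → ℂ) (S : Finset α) : ℂ[X] :=
  ∏ i, (1 + C (if i ∈ S then x i else y i) * X)

theorem choiceProd_disjSum {α β : Type*} [Fintype α] [Fintype β] (x y : α ⊕ β → ℂ) (S : Finset α)
    (T : Finset β) : choiceProd x y (S.disjSum T) =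
      choiceProd (fun i => x (Sum.inl i)) (fun i => y (Sum.inl i)) S *
      choiceProd (fun i => x (Sum.inr i)) (fun i => y (Sum.inr i)) T := by
  classical
  unfold choiceProd
  rw [Fintype.prod_sum_type]
  congr 1 <;> refine Finset.prod_congr rfl fun i _ => ?_
  · by_cases h : i ∈ S <;> simp [h]
  · by_cases h : i ∈ T <;> simp [h]

/-- Constant coefficients equal `1` and cancel, whence the factor `X`. The linear coefficient of the
difference is the sum of `x i - y i` over the nonempty set `S' \ S`; after rotation by `θ` the real
parts are positive and cannot cancel. -/
theorem exists_choiceProd_sub_eq {α : Type*} [Fintype α] {x y : α → ℂ} {θ : ℂ} (hθ : ‖θ‖ ≤ 1)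
    {δ : ℝ} (hδ : 0 < δ) (hxy : ∀ i, δ ≤ (θ * (x i - y i)).re) {S S' : Finset α} (h : S ⊂ S') :
    ∃ D : ℂ[X], choiceProd x y S' - choiceProd x y S = X * D ∧ δ ≤ ‖D.coeff 0‖ := by
  classical
  refine ⟨(choiceProd x y S' - choiceProd x y S).divX, ?_, ?_⟩
  · have h1 := X_mul_divX_add (choiceProd x y S' - choiceProd x y S)
    rw [coeff_sub] at h1
    unfold choiceProd at h1 ⊢
    rw [coeff_zero_prod_one_add, coeff_zero_prod_one_add, sub_self, C_0, add_zero] at h1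
    exact h1.symm
  · rw [coeff_divX, zero_add, coeff_sub]
    unfold choiceProd
    rw [coeff_one_prod_one_add, coeff_one_prod_one_add, ← Finset.sum_sub_distrib]
    have h2 : ∑ i, ((if i ∈ S' then x i else y i) - (if i ∈ S then x i else y i)) =
        ∑ i ∈ S' \ S, (x i - y i) := by
      rw [← Finset.sum_filter_add_sum_filter_not Finset.univ (fun i => i ∈ S' \ S)]
      rw [Finset.sum_eq_zero (s := Finset.univ.filter fun i => ¬ i ∈ S' \ S), add_zero]
      · rw [Finset.filter_mem_eq_inter, Finset.univ_inter]
        refine Finset.sum_congr rfl fun i hi => ?_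
        rw [Finset.mem_sdiff] at hi
        simp [hi.1, hi.2]
      · intro i hi
        simp only [Finset.mem_filter, Finset.mem_univ, true_and, Finset.mem_sdiff, not_and,
          not_not] at hi
        by_cases h1 : i ∈ S
        · simp [h1, h.1 h1]
        · simp [h1, show i ∉ S' from fun h3 => h1 (hi h3)]
    have h3 : δ ≤ (θ * ∑ i ∈ S' \ S, (x i - y i)).re := by
      rw [Finset.mul_sum, Complex.re_sum]
      obtain ⟨i, hi⟩ : (S' \ S).Nonempty := Finset.sdiff_nonempty.2 h.2
      exact (hxy i).trans (Finset.single_le_sum (f := fun i => (θ * (x i - y i)).re)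
        (fun i _ => hδ.le.trans (hxy i)) hi)
    have h4 : (θ * ∑ i ∈ S' \ S, (x i - y i)).re ≤ ‖∑ i ∈ S' \ S, (x i - y i)‖ := by
      refine (Complex.re_le_norm _).trans ?_
      rw [norm_mul]
      exact mul_le_of_le_one_left (norm_nonneg _) hθ
    refine (h3.trans h4).trans (le_of_eq (congrArg norm ?_))
    convert h2.symm using 2

open Classical in
theorem card_filter_finset_sum {α β : Type*} [Fintype α] [Fintype β]
    (p : Finset (α ⊕ β) → Prop) :
    (Finset.univ.filter p).card =
      ∑ T : Finset β, (Finset.univ.filter fun S : Finset α => p (S.disjSum T)).card := by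
  simp_rw [Finset.card_filter]
  rw [Finset.sum_comm, ← Fintype.sum_prod_type', ← Finset.sumEquiv.symm.toEquiv.sum_comp]
  rfl

/-- If a family of subfamilies of a cube rarely contains a given strictly comparable pair, its
members are small on average. -/
theorem sum_card_le_of_card_pair_le {β : Type*} [Fintype β] {m : ℕ} {η ε : ℝ} (hη : 0 ≤ η)
    (hε : 0 ≤ ε)
    (hm : ∀ A : Finset (Finset (Fin m)), IsAntichain (· ⊆ ·) (A : Set (Finset (Fin m))) →
      (A.card : ℝ) ≤ η * 2 ^ m)
    (E : β → Finset (Finset (Fin m)))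
    (hpair : ∀ S S' : Finset (Fin m), S ⊂ S' → ∀ N : Finset β, (∀ T ∈ N, S ∈ E T ∧ S' ∈ E T) →
      (N.card : ℝ) ≤ ε) :
    ∑ T, ((E T).card : ℝ) ≤ Fintype.card β * (η * 2 ^ m) + 4 ^ m * ε * 2 ^ m := by
  classical
  -- `N` collects the `T` for which `E T` is not an antichain. Each has a comparable pair, and there
  -- are at most `4 ^ m` pairs; on `N` the trivial bound `2 ^ m` is used, elsewhere the antichain
  -- bound.
  set N : Finset β := Finset.univ.filter fun T =>
    ¬ IsAntichain (· ⊆ ·) (E T : Set (Finset (Fin m))) with hN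
  have hNcard : (N.card : ℝ) ≤ 4 ^ m * ε := by
    have hsub : N ⊆ (Finset.univ : Finset (Finset (Fin m) × Finset (Fin m))).biUnion fun q =>
        Finset.univ.filter fun T => q.1 ⊂ q.2 ∧ q.1 ∈ E T ∧ q.2 ∈ E T := by
      intro T hT
      have hT' := (Finset.mem_filter.1 hT).2
      simp only [IsAntichain, Set.Pairwise] at hT'
      push Not at hT'
      obtain ⟨S, h1, S', h2, hne, hle⟩ := hT'
      exact Finset.mem_biUnion.2 ⟨(S, S'), Finset.mem_univ _, Finset.mem_filter.2
        ⟨Finset.mem_univ _, Finset.ssubset_iff_subset_ne.2 ⟨not_not.1 hle, hne⟩, h1, h2⟩⟩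
    have h1 : (N.card : ℝ) ≤ ∑ q : Finset (Fin m) × Finset (Fin m),
        ((Finset.univ.filter fun T => q.1 ⊂ q.2 ∧ q.1 ∈ E T ∧ q.2 ∈ E T).card : ℝ) := by
      exact_mod_cast (Finset.card_le_card hsub).trans Finset.card_biUnion_le
    have h2 : ∀ q : Finset (Fin m) × Finset (Fin m),
        ((Finset.univ.filter fun T => q.1 ⊂ q.2 ∧ q.1 ∈ E T ∧ q.2 ∈ E T).card : ℝ) ≤ ε := by
      intro q
      by_cases hq : q.1 ⊂ q.2
      · exact hpair q.1 q.2 hq _ fun T hT => (Finset.mem_filter.1 hT).2.2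
      · rw [Finset.filter_false_of_mem fun T _ h => hq h.1]
        simpa using hε
    refine (h1.trans (Finset.sum_le_sum fun q _ => h2 q)).trans (le_of_eq ?_)
    rw [Finset.sum_const, Finset.card_univ, Fintype.card_prod, Fintype.card_finset,
      Fintype.card_fin, nsmul_eq_mul, ← mul_pow]
    norm_num
  have hT : ∀ T : β, ((E T).card : ℝ) ≤ η * 2 ^ m + if T ∈ N then 2 ^ m else 0 := by
    intro T
    by_cases h : T ∈ N
    · have h1 : (E T).card ≤ 2 ^ m := by
        simpa using Finset.card_le_univ (E T)
      have h2 : ((E T).card : ℝ) ≤ 2 ^ m := by exact_mod_cast h1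
      rw [if_pos h]
      have : 0 ≤ η * 2 ^ m := by positivity
      linarith
    · rw [if_neg h, add_zero]
      refine hm _ (not_not.1 fun h' => h (Finset.mem_filter.2 ⟨Finset.mem_univ _, h'⟩))
  refine (Finset.sum_le_sum fun T _ => hT T).trans ?_
  rw [Finset.sum_add_distrib, Finset.sum_const, Finset.card_univ, ← Finset.sum_filter,
    Finset.sum_const, Finset.filter_mem_eq_inter, Finset.univ_inter, nsmul_eq_mul, nsmul_eq_mul]
  gcongr

theorem coeff_eq_sub_of_sub_eq {A A' B D H : ℂ[X]} (hD : A' - A = X * D) (k : ℕ) :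
    (H * D * B).coeff k = (H * (A' * B)).coeff (k + 1) - (H * (A * B)).coeff (k + 1) := by
  have h : H * (A' * B) = X * (H * D * B) + H * (A * B) := by linear_combination H * B * hD
  rw [h, coeff_add, coeff_X_mul, add_sub_cancel_right]

open Classical in
/-- Anti-concentration for a coefficient of a product of random linear factors: if the pairs of
choices differ in a common half-plane, few choices make the coefficient small. -/
theorem exists_card_choiceProd_le (k : ℕ) : ∀ η : ℝ, 0 < η → ∃ (α : Type) (_ : Fintype α),
    ∀ (x y : α → ℂ) (θ : ℂ) (δ c r : ℝ) (H : ℂ[X]), ‖θ‖ ≤ 1 → 0 < δ →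
      (∀ i, δ ≤ (θ * (x i - y i)).re) → 0 < c → c ≤ ‖H.coeff 0‖ → 2 ^ k * r < c * δ ^ k →
      ((Finset.univ.filter fun S : Finset α => ‖(H * choiceProd x y S).coeff k‖ ≤ r).card : ℝ) ≤
        η * 2 ^ Fintype.card α := by
  induction k with
  | zero =>
    intro η hη
    -- For `k = 0` the coefficient is that of `H`, of norm at least `c > r`, so no choice is bad and
    -- an empty cube will do.
    refine ⟨Empty, inferInstance, fun x y θ δ c r H _ _ _ _ hH hr => ?_⟩
    rw [Finset.filter_false_of_mem]
    · simpa using hη.le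
    · intro S _ hS
      rw [mul_coeff_zero, choiceProd, coeff_zero_prod_one_add, mul_one] at hS
      simp only [pow_zero, one_mul, mul_one] at hr
      linarith
  | succ k ih =>
    intro η hη
    obtain ⟨m, hm⟩ := exists_antichain_card_le (half_pos hη)
    -- The division by `4 ^ m` absorbs the number of comparable pairs, leaving `η / 2` for the
    -- exceptional `T` and `η / 2` for the antichains.
    obtain ⟨β, _, hβ⟩ := ih (η / 2 / 4 ^ m) (by positivity)
    refine ⟨Fin m ⊕ β, inferInstance, fun x y θ δ c r H hθ hδ hxy hc hH hr => ?_⟩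
    rw [card_filter_finset_sum, Nat.cast_sum]
    refine (sum_card_le_of_card_pair_le (half_pos hη).le
      (ε := η / 2 / 4 ^ m * 2 ^ Fintype.card β) (by positivity) hm _ ?_).trans (le_of_eq ?_)
    -- If `S ⊂ S'` both make the coefficient of index `k + 1` small with the same `T`, subtracting
    -- removes a factor `X` and makes that of index `k` small. The induction hypothesis applies with
    -- `H * D`, `c * δ` and `2 * r` for `H`, `c` and `r`.
    · intro S S' hS N hNS
      obtain ⟨D, hD, hDδ⟩ := exists_choiceProd_sub_eq (x := fun i => x (Sum.inl i))
        (y := fun i => y (Sum.inl i)) hθ hδ (fun i => hxy (Sum.inl i)) hS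
      refine le_trans ?_ (hβ (fun i => x (Sum.inr i)) (fun i => y (Sum.inr i)) θ δ (c * δ) (2 * r)
        (H * D) hθ hδ (fun i => hxy (Sum.inr i)) (by positivity) ?_ ?_)
      · rw [Nat.cast_le]
        refine Finset.card_le_card fun T hT => Finset.mem_filter.2 ⟨Finset.mem_univ _, ?_⟩
        obtain ⟨h1, h2⟩ := hNS T hT
        replace h1 := (Finset.mem_filter.1 h1).2
        replace h2 := (Finset.mem_filter.1 h2).2
        rw [choiceProd_disjSum] at h1 h2
        rw [coeff_eq_sub_of_sub_eq hD]
        exact (norm_sub_le _ _).trans (by linarith)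
      · rw [mul_coeff_zero, norm_mul]
        gcongr
      · rw [pow_succ, pow_succ] at hr
        linarith
    · rw [Fintype.card_finset, Fintype.card_sum, Fintype.card_fin, pow_add]
      push_cast
      field_simp
      ring

/-! ### Small values of `ratioCoeff` are improbable -/

/-- The coefficient of `t ^ k` in `∏ (1 + t / (z - x i))`, which is `p⁽ᵏ⁾(z) / (k! p(z))` for the
monic polynomial `p` with zeros `x 0, …, x (n - 1)`. -/
noncomputable def ratioCoeff (x : ℕ → ℂ) (n k : ℕ) (z : ℂ) : ℂ :=
  (∏ i ∈ Finset.range n, (1 + C ((z - x i)⁻¹) * X)).coeff k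

theorem measurable_coeff_prod {ι Ω : Type*} [MeasurableSpace Ω] (s : Finset ι) {u : ι → Ω → ℂ}
    (hu : ∀ i, Measurable (u i)) (k : ℕ) :
    Measurable fun ω => (∏ i ∈ s, (1 + C (u i ω) * X)).coeff k := by
  classical
  induction s using Finset.induction_on generalizing k with
  | empty => simp
  | insert a s ha ih =>
    have e : ∀ ω, (∏ i ∈ insert a s, (1 + C (u i ω) * X)).coeff k =
        (∏ i ∈ s, (1 + C (u i ω) * X)).coeff k +
          u a ω * (X * ∏ i ∈ s, (1 + C (u i ω) * X)).coeff k := fun ω => by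
      rw [Finset.prod_insert ha, add_mul, one_mul, coeff_add, mul_assoc, coeff_C_mul]
    simp_rw [e]
    refine (ih k).add ((hu a).mul ?_)
    cases k with
    | zero => simp
    | succ k => simpa only [coeff_X_mul] using ih k

theorem measure_preimage_singleton_eq {Ω : Type*} [MeasurableSpace Ω] {P : Measure Ω} {a b c : ℂ}
    (hab : a ≠ b) {ξ : Ω → ℂ} (hξ : Measurable ξ)
    (hlaw : P.map ξ = (2⁻¹ : ℝ≥0∞) • Measure.dirac a + (2⁻¹ : ℝ≥0∞) • Measure.dirac b)
    (hc : c = a ∨ c = b) : P (ξ ⁻¹' {c}) = 2⁻¹ := by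
  rw [← Measure.map_apply hξ (measurableSet_singleton c), hlaw]
  rcases hc with rfl | rfl
  · simp [hab.symm]
  · simp [hab]

theorem ae_eq_or_eq {Ω : Type*} [MeasurableSpace Ω] {P : Measure Ω} {a b : ℂ}
    {ξ : Ω → ℂ} (hξ : Measurable ξ)
    (hlaw : P.map ξ = (2⁻¹ : ℝ≥0∞) • Measure.dirac a + (2⁻¹ : ℝ≥0∞) • Measure.dirac b) :
    ∀ᵐ ω ∂P, ξ ω = a ∨ ξ ω = b := by
  refine ae_of_ae_map hξ.aemeasurable (p := fun w => w = a ∨ w = b) ?_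
  rw [hlaw, ae_iff]
  have : MeasurableSet {w : ℂ | ¬ (w = a ∨ w = b)} :=
    ((measurableSet_singleton a).union (measurableSet_singleton b)).compl
  rw [Measure.add_apply, Measure.smul_apply, Measure.smul_apply, Measure.dirac_apply' _ this,
    Measure.dirac_apply' _ this]
  simp

/-- Every nonzero complex number acquires positive real part under one of the rotations by `1`,
`-1`, `I`, `-I`, so one of these four serves infinitely many indices. -/
theorem exists_infinite_re_pos {s : Set ℕ} (hs : s.Infinite) {d : ℕ → ℂ} (hd : ∀ i ∈ s, d i ≠ 0) :
    ∃ θ : ℂ, ‖θ‖ ≤ 1 ∧ {i | i ∈ s ∧ 0 < (θ * d i).re}.Infinite := by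
  by_contra hcon
  push Not at hcon
  have h := hcon
  refine hs ((((h 1 (by simp)).union (h (-1) (by simp))).union
    ((h Complex.I (by simp)).union (h (-Complex.I) (by simp)))).subset fun i hi => ?_)
  have hne := hd i hi
  by_contra hmem
  simp only [Set.mem_union, Set.mem_ofPred_eq, not_or, not_and, not_lt] at hmem
  obtain ⟨⟨h1, h2⟩, h3, h4⟩ := hmem
  have h1 := h1 hi
  have h2 := h2 hi
  have h3 := h3 hi
  have h4 := h4 hi
  simp at h1 h2 h3 h4
  exact hne (Complex.ext (le_antisymm h1 h2) (le_antisymm h4 h3))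

theorem exists_pos_forall_le {α : Type*} [Finite α] {f : α → ℝ} (hf : ∀ i, 0 < f i) :
    ∃ δ > 0, ∀ i, δ ≤ f i := by
  have h : ∀ᶠ δ in 𝓝[>] (0 : ℝ), ∀ i, δ ≤ f i := eventually_all.2 fun i =>
    (eventually_le_nhds (hf i)).filter_mono nhdsWithin_le_nhds
  obtain ⟨δ, h1, h2⟩ := (h.and self_mem_nhdsWithin).exists
  exact ⟨δ, h2, h1⟩

/-- Fix a finite block of indices with `a i ≠ b i` whose differences of inverses lie in a common
half-plane. Given the other variables, the block is a uniform point of a cube, and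
anti-concentration bounds the proportion of bad vertices by `η`; block and gap `δ` do not depend on
`n`. -/
theorem tendsto_measure_ratioCoeff_le {Ω : Type*} [MeasurableSpace Ω] {P : Measure Ω}
    [IsProbabilityMeasure P] {a b : ℕ → ℂ} (hab : {i : ℕ | a i ≠ b i}.Infinite)
    {ξ : ℕ → Ω → ℂ} (hξ_meas : ∀ i, Measurable (ξ i)) (hξ_indep : iIndepFun ξ P)
    (hξ_law : ∀ i, P.map (ξ i) =
      (2⁻¹ : ℝ≥0∞) • Measure.dirac (a i) + (2⁻¹ : ℝ≥0∞) • Measure.dirac (b i))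
    (k : ℕ) {z : ℂ} {ε : ℝ} (hε : 0 < ε) :
    Tendsto (fun n : ℕ => P {ω | ‖ratioCoeff (fun i => ξ i ω) n k z‖ ≤ Real.exp (-(ε * n))})
      atTop (𝓝 0) := by
  classical
  rw [ENNReal.tendsto_nhds_zero]
  intro η' hη'
  obtain ⟨η, hη0, hηle⟩ : ∃ η : ℝ, 0 < η ∧ ENNReal.ofReal η ≤ η' := by
    rcases eq_or_ne η' ∞ with rfl | h
    · exact ⟨1, one_pos, le_top⟩
    · exact ⟨η'.toReal, ENNReal.toReal_pos hη'.ne' h, ENNReal.ofReal_toReal_le⟩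
  obtain ⟨α, _, hα⟩ := exists_card_choiceProd_le k η hη0
  set d : ℕ → ℂ := fun i => (z - a i)⁻¹ - (z - b i)⁻¹ with hd
  -- Inversion with `0⁻¹ = 0` is injective on all of `ℂ`, so `d i ≠ 0` even when `z` equals `a i` or
  -- `b i`.
  obtain ⟨θ, hθ, hinf⟩ := exists_infinite_re_pos hab (d := d) fun i hi h0 => hi (by
    have := inv_injective (sub_eq_zero.1 h0)
    exact sub_right_injective this)
  obtain ⟨e, he⟩ : ∃ e : α ↪ ℕ, ∀ i, a (e i) ≠ b (e i) ∧ 0 < (θ * d (e i)).re :=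
    ⟨((Fintype.equivFin α).toEmbedding.trans Fin.valEmbedding).trans
      ((hinf.natEmbedding _).trans (Function.Embedding.subtype _)),
      fun i => (hinf.natEmbedding _ _).2⟩
  obtain ⟨δ, hδ, hδle⟩ := exists_pos_forall_le fun i => (he i).2
  have hr : ∀ᶠ n : ℕ in atTop, 2 ^ k * Real.exp (-(ε * n)) < 1 * δ ^ k := by
    have h1 : Tendsto (fun n : ℕ => 2 ^ k * Real.exp (-(ε * n))) atTop (𝓝 (2 ^ k * 0)) := by
      refine Tendsto.const_mul _ (Real.tendsto_exp_neg_atTop_nhds_zero.comp ?_)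
      exact tendsto_natCast_atTop_atTop.const_mul_atTop hε
    rw [mul_zero] at h1
    exact h1.eventually_lt_const (by positivity)
  have hN : ∀ᶠ n : ℕ in atTop, ∀ i, e i < n := eventually_all.2 fun i => eventually_gt_atTop _
  filter_upwards [hr, hN] with n hr hN
  refine le_trans ?_ hηle
  set r := Real.exp (-(ε * n)) with hrdef
  set I : Finset ℕ := Finset.univ.map e with hI
  have hIn : I ⊆ Finset.range n := fun i hi => by
    obtain ⟨j, -, rfl⟩ := Finset.mem_map.1 hi
    exact Finset.mem_range.2 (hN j)
  set J : Finset ℕ := Finset.range n \ I with hJ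
  set x : α → ℂ := fun i => (z - a (e i))⁻¹ with hx
  set y : α → ℂ := fun i => (z - b (e i))⁻¹ with hy
  set H : (J → ℂ) → ℂ[X] := fun v => ∏ j : J, (1 + C ((z - v j)⁻¹) * X) with hH
  set Y : Ω → J → ℂ := fun ω j => ξ j ω with hY
  set W : Ω → I → ℂ := fun ω i => ξ i ω with hW
  have hYm : Measurable Y := measurable_pi_lambda _ fun j => hξ_meas j
  set B : Finset α → Set (J → ℂ) := fun S => {v | ‖(H v * choiceProd x y S).coeff k‖ ≤ r} with hB
  have hBm : ∀ S, MeasurableSet (B S) := by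
    intro S
    refine measurableSet_le (Measurable.norm ?_) measurable_const
    simp_rw [coeff_mul]
    refine Finset.measurable_sum _ fun p _ => Measurable.mul_const ?_ _
    exact measurable_coeff_prod Finset.univ (u := fun (j : J) (v : J → ℂ) => (z - v j)⁻¹)
      (fun j => by fun_prop) p.1
  set c : Finset α → α → ℂ := fun S i => if i ∈ S then a (e i) else b (e i) with hc
  set V : Finset α → Set (I → ℂ) := fun S =>
    {v | ∀ i : α, v ⟨e i, Finset.mem_map_of_mem e (Finset.mem_univ i)⟩ = c S i} with hV
  have hVm : ∀ S, MeasurableSet (V S) := fun S => by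
    simp only [hV, Set.ofPred_forall]
    exact MeasurableSet.iInter fun i => measurableSet_eq_fun (measurable_pi_apply _) measurable_const
  have hVP : ∀ S, P (W ⁻¹' V S) = (2⁻¹ : ℝ≥0∞) ^ Fintype.card α := by
    intro S
    have h1 := (hξ_indep.precomp e.injective).measure_inter_preimage_eq_mul Finset.univ
      (sets := fun i => {c S i}) fun i _ => measurableSet_singleton _
    have h2 : W ⁻¹' V S = ⋂ i ∈ (Finset.univ : Finset α), ξ (e i) ⁻¹' {c S i} := by
      ext ω
      simp [hV, hW]
    rw [h2, h1, Finset.prod_congr rfl fun i _ => measure_preimage_singleton_eq (he i).1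
      (hξ_meas (e i)) (hξ_law (e i)) (c := c S i) (by
        by_cases h : i ∈ S <;> simp [hc, h])]
    simp
  have hWY : IndepFun W Y P :=
    hξ_indep.indepFun_finset I J Finset.disjoint_sdiff hξ_meas
  -- Almost surely the block `W` sits at a vertex `S`, and the product splits into the frozen factor
  -- `H (Y ω)` times `choiceProd x y S`.
  have hcover : ∀ᵐ ω ∂P, ω ∈ {ω | ‖ratioCoeff (fun i => ξ i ω) n k z‖ ≤ r} →
      ω ∈ ⋃ S ∈ (Finset.univ : Finset (Finset α)), W ⁻¹' V S ∩ Y ⁻¹' B S := by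
    filter_upwards [ae_all_iff.2 fun i => ae_eq_or_eq (hξ_meas i) (hξ_law i)] with ω hω hmem
    set S : Finset α := Finset.univ.filter fun i => ξ (e i) ω = a (e i) with hS
    have hcS : ∀ i, ξ (e i) ω = c S i := fun i => by
      by_cases h : ξ (e i) ω = a (e i)
      · simp [hc, hS, h]
      · simp [hc, hS, (hω (e i)).resolve_left h]
    simp only [Finset.mem_univ, Set.iUnion_true, Set.mem_iUnion]
    refine ⟨S, hcS, ?_⟩
    have e1 : (∏ i ∈ Finset.range n, (1 + C ((z - ξ i ω)⁻¹) * X)) = H (Y ω) * choiceProd x y S := by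
      rw [← Finset.prod_sdiff hIn, hI, Finset.prod_map, hH, ← hI, ← hJ]
      congr 1
      · exact (Finset.prod_coe_sort J fun j => (1 + C ((z - ξ j ω)⁻¹) * X)).symm
      · refine Finset.prod_congr rfl fun i _ => ?_
        rw [hcS i]
        by_cases h : i ∈ S <;> simp [hc, h, hx, hy]
    simp only [ratioCoeff, e1] at hmem
    exact hmem
  calc P {ω | ‖ratioCoeff (fun i => ξ i ω) n k z‖ ≤ r}
      ≤ P (⋃ S ∈ (Finset.univ : Finset (Finset α)), W ⁻¹' V S ∩ Y ⁻¹' B S) := measure_mono_ae hcover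
    _ ≤ ∑ S : Finset α, P (W ⁻¹' V S ∩ Y ⁻¹' B S) := measure_biUnion_finset_le _ _
    _ = ∑ S : Finset α, (2⁻¹ : ℝ≥0∞) ^ Fintype.card α * P (Y ⁻¹' B S) := by
        refine Finset.sum_congr rfl fun S _ => ?_
        rw [hWY.measure_inter_preimage_eq_mul _ _ (hVm S) (hBm S), hVP]
    _ = (2⁻¹ : ℝ≥0∞) ^ Fintype.card α *
          ∫⁻ ω, ∑ S : Finset α, (Y ⁻¹' B S).indicator 1 ω ∂P := by
        rw [← Finset.mul_sum, lintegral_finsetSum _ fun S _ =>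
          measurable_one.indicator (hYm (hBm S))]
        simp_rw [lintegral_indicator_one (hYm (hBm _))]
    _ ≤ (2⁻¹ : ℝ≥0∞) ^ Fintype.card α * ∫⁻ _ω, ENNReal.ofReal (η * 2 ^ Fintype.card α) ∂P := by
        gcongr with ω
        -- Here `c = 1`, since the frozen factor has constant coefficient `1` whatever the other
        -- variables are.
        have h1 := hα x y θ δ 1 r (H (Y ω)) hθ hδ hδle one_pos
          (by rw [hH, coeff_zero_prod_one_add, norm_one]) hr
        have h2 : ∑ S : Finset α, (Y ⁻¹' B S).indicator (1 : Ω → ℝ≥0∞) ω =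
            ((Finset.univ.filter fun S : Finset α =>
              ‖(H (Y ω) * choiceProd x y S).coeff k‖ ≤ r).card : ℝ≥0∞) := by
          rw [Finset.card_filter, Nat.cast_sum]
          refine Finset.sum_congr rfl fun S _ => ?_
          simp [Set.indicator_apply, hB]
        rw [h2, ← ENNReal.ofReal_natCast]
        exact ENNReal.ofReal_le_ofReal h1
    _ = ENNReal.ofReal η := by
        rw [lintegral_const, measure_univ, mul_one, ENNReal.ofReal_mul hη0.le, mul_left_comm,
          ENNReal.ofReal_pow two_pos.le, ENNReal.ofReal_ofNat, ← mul_pow,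
          ENNReal.inv_mul_cancel two_ne_zero ENNReal.ofNat_ne_top, one_pow, mul_one]

/-! ### Circle averages: Jensen's formula and a uniform singular integral -/

/-- The uniform probability measure on the circle with centre `c` and radius `r`. -/
noncomputable def circleMeasure (c : ℂ) (r : ℝ) : Measure ℂ :=
  ENNReal.ofReal (2 * Real.pi)⁻¹ •
    (volume.restrict (Set.Ioc 0 (2 * Real.pi))).map (circleMap c r)

instance isProbabilityMeasure_circleMeasure (c : ℂ) (r : ℝ) :
    IsProbabilityMeasure (circleMeasure c r) := by
  refine ⟨?_⟩
  rw [circleMeasure, Measure.smul_apply, Measure.map_apply (measurable_circleMap c r)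
    MeasurableSet.univ, Set.preimage_univ, Measure.restrict_apply_univ, Real.volume_Ioc, sub_zero,
    smul_eq_mul, ← ENNReal.ofReal_mul (by positivity), inv_mul_cancel₀ Real.two_pi_pos.ne',
    ENNReal.ofReal_one]

theorem integrable_circleMeasure {f : ℂ → ℝ} (hf : Measurable f) {c : ℂ} {r : ℝ}
    (h : CircleIntegrable f c r) : Integrable f (circleMeasure c r) := by
  refine Integrable.smul_measure ?_ ENNReal.ofReal_ne_top
  rw [integrable_map_measure hf.aestronglyMeasurable (measurable_circleMap c r).aemeasurable]
  exact (intervalIntegrable_iff_integrableOn_Ioc_of_le Real.two_pi_pos.le).1 h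

theorem integral_circleMeasure {f : ℂ → ℝ} (hf : Measurable f) (c : ℂ) (r : ℝ) :
    ∫ z, f z ∂circleMeasure c r = Real.circleAverage f c r := by
  rw [circleMeasure, integral_smul_measure, integral_map (measurable_circleMap c r).aemeasurable
    hf.aestronglyMeasurable, Real.circleAverage_def, intervalIntegral.integral_of_le
    Real.two_pi_pos.le, ENNReal.toReal_ofReal (by positivity)]

theorem ae_norm_le_circleMeasure (c : ℂ) (r : ℝ) :
    ∀ᵐ z ∂circleMeasure c r, ‖z‖ ≤ ‖c‖ + |r| := by
  refine Measure.ae_smul_measure ?_ _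
  rw [ae_map_iff (measurable_circleMap c r).aemeasurable
    (measurableSet_le measurable_norm measurable_const)]
  refine ae_of_all _ fun θ => ?_
  rw [circleMap]
  refine (norm_add_le _ _).trans ?_
  rw [norm_mul, Complex.norm_exp_ofReal_mul_I, mul_one, Complex.norm_real, Real.norm_eq_abs]

theorem measurable_log_norm_sub (w : ℂ) : Measurable fun z : ℂ => Real.log ‖z - w‖ :=
  Real.measurable_log.comp (measurable_id.sub_const w).norm

theorem integrable_log_norm_sub (c : ℂ) (r : ℝ) (w : ℂ) :
    Integrable (fun z => Real.log ‖z - w‖) (circleMeasure c r) :=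
  integrable_circleMeasure (measurable_log_norm_sub w) (circleIntegrable_log_norm_sub_const r)

theorem integral_log_norm_sub (c : ℂ) {r : ℝ} (hr : 0 < r) (w : ℂ) :
    ∫ z, Real.log ‖z - w‖ ∂circleMeasure c r = Real.log (max r ‖w - c‖) := by
  rw [integral_circleMeasure (measurable_log_norm_sub w),
    circleAverage_log_norm_sub_const_eq_log_radius_add_posLog hr.ne',
    Real.posLog_eq_log_max_one (by positivity),
    ← Real.log_mul hr.ne' (lt_max_of_lt_left one_pos).ne', mul_max_of_nonneg _ _ hr.le, mul_one,
    mul_inv_cancel_left₀ hr.ne', norm_sub_rev]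

theorem integral_log_norm_sub_sub (c : ℂ) {s : ℝ} (hs : 0 < s) (w : ℂ) :
    ∫ z, Real.log ‖z - w‖ ∂circleMeasure c (2 * s) - ∫ z, Real.log ‖z - w‖ ∂circleMeasure c s =
      tent s (w - c) := by
  rw [integral_log_norm_sub c (by positivity), integral_log_norm_sub c hs, tent]

theorem lintegral_enorm_rpow_neg_half_lt_top (T : ℝ) :
    ∫⁻ t in Set.Ioc (-T) T, ‖t‖ₑ ^ (-(1 / 2) : ℝ) < ∞ := by
  rcases le_or_gt T 0 with hT | hT
  · rw [Set.Ioc_eq_empty (by linarith)]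
    simp
  have h1 : IntervalIntegrable (fun t : ℝ => |t| ^ (-(1 / 2) : ℝ)) volume 0 T := by
    refine (intervalIntegral.intervalIntegrable_rpow' (r := -(1 / 2)) (by norm_num)).congr ?_
    intro t ht
    rw [Set.uIoc_of_le hT.le] at ht
    simp only [abs_of_pos ht.1]
  have h2 : IntervalIntegrable (fun t : ℝ => |t| ^ (-(1 / 2) : ℝ)) volume (-T) 0 := by
    have := (IntervalIntegrable.iff_comp_neg (f := fun t : ℝ => |t| ^ (-(1 / 2) : ℝ))
      (a := 0) (b := T) (by simp)).1 h1
    simp only [abs_neg, neg_zero] at this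
    exact this.symm
  have h3 := (intervalIntegrable_iff_integrableOn_Ioc_of_le (by linarith)).1 (h2.trans h1)
  have h4 : ∫⁻ t in Set.Ioc (-T) T, ‖t‖ₑ ^ (-(1 / 2) : ℝ) =
      ∫⁻ t in Set.Ioc (-T) T, ‖|t| ^ (-(1 / 2) : ℝ)‖ₑ := by
    refine lintegral_congr_ae ?_
    have h0 : ∀ᵐ t ∂(volume : Measure ℝ), t ≠ 0 := by simp [ae_iff]
    filter_upwards [ae_restrict_of_ae h0] with t ht
    have : 0 < |t| := abs_pos.2 ht
    rw [Real.enorm_eq_ofReal_abs t, ENNReal.ofReal_rpow_of_pos this,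
      Real.enorm_of_nonneg (by positivity)]
  rw [h4]
  exact h3.2

/-- Rotating so that `w - c` becomes a nonnegative real, the imaginary part alone gives the bound,
with no dependence on `‖w - c‖`. -/
theorem norm_circleMap_sub_ge {r : ℝ} (hr : 0 ≤ r) (c w : ℂ) (t : ℝ) :
    r * |Real.sin (t - (w - c).arg)| ≤ ‖circleMap c r t - w‖ := by
  set α := (w - c).arg with hα
  have h1 : ‖circleMap c r t - w‖ =
      ‖(circleMap c r t - w) * Complex.exp ((-α : ℝ) * Complex.I)‖ := by
    rw [norm_mul, Complex.norm_exp_ofReal_mul_I, mul_one]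
  have h2 : (circleMap c r t - w) * Complex.exp ((-α : ℝ) * Complex.I) =
      r * Complex.exp ((t - α : ℝ) * Complex.I) - ‖w - c‖ := by
    have h3 : w - c = ‖w - c‖ * Complex.exp (α * Complex.I) := (Complex.norm_mul_exp_arg_mul_I _).symm
    have h4 : circleMap c r t - w = r * Complex.exp (t * Complex.I) - (w - c) := by
      rw [circleMap]
      ring
    rw [h4, sub_mul, h3, mul_assoc, mul_assoc, ← Complex.exp_add, ← Complex.exp_add, ← h3]
    congr 1
    · congr 2
      push_cast
      ring
    · push_cast
      rw [neg_mul, add_neg_cancel, Complex.exp_zero, mul_one]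
  rw [h1, h2]
  refine le_trans (le_of_eq ?_) (Complex.abs_im_le_norm _)
  rw [Complex.sub_im, Complex.ofReal_im, sub_zero, Complex.im_ofReal_mul,
    Complex.exp_ofReal_mul_I_im, abs_mul, abs_of_nonneg hr]

theorem rpow_neg_half_anti {x y : ℝ≥0∞} (h : x ≤ y) :
    y ^ (-(1 / 2) : ℝ) ≤ x ^ (-(1 / 2) : ℝ) := by
  rw [ENNReal.rpow_neg, ENNReal.rpow_neg]
  exact ENNReal.inv_le_inv.2 (ENNReal.rpow_le_rpow h (by norm_num))

theorem setLIntegral_comp_sub_le {A B : Set ℝ} (hA : MeasurableSet A) (hB : MeasurableSet B) {a : ℝ}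
    (h : ∀ t ∈ A, t - a ∈ B) (g : ℝ → ℝ≥0∞) : ∫⁻ t in A, g (t - a) ≤ ∫⁻ t in B, g t := by
  rw [← lintegral_indicator hA, ← lintegral_indicator hB,
    ← lintegral_sub_right_eq_self (B.indicator g) a]
  refine lintegral_mono fun t => ?_
  by_cases ht : t ∈ A
  · simp [ht, h t ht]
  · simp [ht]

/-- Jordan's inequality at the multiple of `π` nearest to `t`. The interval contains every shift of
`(0, 2π]` by an argument, and the nearest multiples there are those with `-1 ≤ j ≤ 3`. -/
theorem enorm_sin_rpow_le {t : ℝ} (ht : t ∈ Set.Icc (-Real.pi) (3 * Real.pi)) :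
    ‖Real.sin t‖ₑ ^ (-(1 / 2) : ℝ) ≤ ∑ j ∈ Finset.Icc (-1 : ℤ) 3,
      ENNReal.ofReal (2 / Real.pi) ^ (-(1 / 2) : ℝ) * ‖t - j * Real.pi‖ₑ ^ (-(1 / 2) : ℝ) := by
  have hpi := Real.pi_pos
  set j := round (t / Real.pi) with hj
  have h1 := abs_sub_round (t / Real.pi)
  rw [← hj, abs_le] at h1
  have h2 : -1 ≤ t / Real.pi := by
    rw [le_div_iff₀ hpi]
    linarith [ht.1]
  have h3 : t / Real.pi ≤ 3 := by
    rw [div_le_iff₀ hpi]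
    linarith [ht.2]
  have hj1 : (-1 : ℤ) ≤ j := by
    have : (-2 : ℝ) < j := by linarith [h1.2]
    have : (-2 : ℤ) < j := by exact_mod_cast this
    linarith
  have hj2 : j ≤ 3 := by
    have : (j : ℝ) < 4 := by linarith [h1.1]
    have : j < 4 := by exact_mod_cast this
    linarith
  refine le_trans ?_ (Finset.single_le_sum (fun _ _ => zero_le) (Finset.mem_Icc.2 ⟨hj1, hj2⟩))
  have e : t - j * Real.pi = (t / Real.pi - j) * Real.pi := by field_simp
  have h4 : |t - j * Real.pi| ≤ Real.pi / 2 := by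
    rw [e, abs_le]
    constructor <;> nlinarith [h1.1, h1.2]
  have h5 := Real.mul_abs_le_abs_sin h4
  have h6 : |Real.sin (t - j * Real.pi)| = |Real.sin t| := by
    rw [Real.sin_sub_int_mul_pi, abs_mul, abs_zpow]
    simp
  rw [h6] at h5
  rw [← ENNReal.mul_rpow_of_ne_top ENNReal.ofReal_ne_top enorm_ne_top, Real.enorm_eq_ofReal_abs,
    Real.enorm_eq_ofReal_abs, ← ENNReal.ofReal_mul (by positivity)]
  exact rpow_neg_half_anti (ENNReal.ofReal_le_ofReal h5)

/-- Uniformity in `w` is the point: the zeros move with `n` and may approach or lie on the circle.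
The exponent `-1/2` is used because `‖z - w‖⁻¹` itself is not integrable for `w` on the circle. -/
theorem exists_lintegral_enorm_sub_rpow_le (c : ℂ) {r : ℝ} (hr : 0 < r) :
    ∃ K : ℝ≥0∞, K ≠ ∞ ∧ ∀ w, ∫⁻ z, ‖z - w‖ₑ ^ (-(1 / 2) : ℝ) ∂circleMeasure c r ≤ K := by
  have hpi := Real.pi_pos
  set N : ℝ≥0∞ := ∫⁻ t in Set.Ioc (-(8 * Real.pi)) (8 * Real.pi), ‖t‖ₑ ^ (-(1 / 2) : ℝ) with hN
  have hNtop : N ≠ ∞ := (lintegral_enorm_rpow_neg_half_lt_top _).ne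
  have hconst : ∀ x : ℝ, 0 < x → ENNReal.ofReal x ^ (-(1 / 2) : ℝ) ≠ ∞ := fun x hx => by
    rw [ENNReal.ofReal_rpow_of_pos hx]
    exact ENNReal.ofReal_ne_top
  refine ⟨ENNReal.ofReal (2 * Real.pi)⁻¹ * (ENNReal.ofReal r ^ (-(1 / 2) : ℝ) *
    ∑ j ∈ Finset.Icc (-1 : ℤ) 3, ENNReal.ofReal (2 / Real.pi) ^ (-(1 / 2) : ℝ) * N), ?_, fun w => ?_⟩
  · refine ENNReal.mul_ne_top ENNReal.ofReal_ne_top (ENNReal.mul_ne_top (hconst r hr) ?_)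
    exact ENNReal.sum_ne_top.2 fun j _ => ENNReal.mul_ne_top (hconst _ (by positivity)) hNtop
  have hm : Measurable fun z : ℂ => ‖z - w‖ₑ ^ (-(1 / 2) : ℝ) := by fun_prop
  rw [circleMeasure, lintegral_smul_measure, lintegral_map hm (measurable_circleMap c r), smul_eq_mul]
  gcongr
  set α := (w - c).arg with hα
  calc ∫⁻ t in Set.Ioc 0 (2 * Real.pi), ‖circleMap c r t - w‖ₑ ^ (-(1 / 2) : ℝ)
      ≤ ∫⁻ t in Set.Ioc 0 (2 * Real.pi), ENNReal.ofReal r ^ (-(1 / 2) : ℝ) *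
          ‖Real.sin (t - α)‖ₑ ^ (-(1 / 2) : ℝ) := by
        refine lintegral_mono fun t => ?_
        rw [← ENNReal.mul_rpow_of_ne_top ENNReal.ofReal_ne_top enorm_ne_top,
          Real.enorm_eq_ofReal_abs, ← ENNReal.ofReal_mul hr.le, ← ofReal_norm]
        exact rpow_neg_half_anti (ENNReal.ofReal_le_ofReal (norm_circleMap_sub_ge hr.le c w t))
    _ = ENNReal.ofReal r ^ (-(1 / 2) : ℝ) *
          ∫⁻ t in Set.Ioc 0 (2 * Real.pi), ‖Real.sin (t - α)‖ₑ ^ (-(1 / 2) : ℝ) :=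
        lintegral_const_mul _ (by fun_prop)
    _ ≤ ENNReal.ofReal r ^ (-(1 / 2) : ℝ) *
          ∫⁻ t in Set.Icc (-Real.pi) (3 * Real.pi), ‖Real.sin t‖ₑ ^ (-(1 / 2) : ℝ) := by
        refine mul_le_mul' le_rfl ?_
        refine setLIntegral_comp_sub_le measurableSet_Ioc measurableSet_Icc (fun t ht => ?_)
          fun t => ‖Real.sin t‖ₑ ^ (-(1 / 2) : ℝ)
        have h1 := Complex.neg_pi_lt_arg (w - c)
        have h2 := Complex.arg_le_pi (w - c)
        exact ⟨by linarith [ht.1], by linarith [ht.2]⟩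
    _ ≤ ENNReal.ofReal r ^ (-(1 / 2) : ℝ) * ∫⁻ t in Set.Icc (-Real.pi) (3 * Real.pi),
          ∑ j ∈ Finset.Icc (-1 : ℤ) 3, ENNReal.ofReal (2 / Real.pi) ^ (-(1 / 2) : ℝ) *
            ‖t - j * Real.pi‖ₑ ^ (-(1 / 2) : ℝ) := by
        refine mul_le_mul' le_rfl ?_
        exact setLIntegral_mono' measurableSet_Icc fun t ht => enorm_sin_rpow_le ht
    _ ≤ _ := by
        refine mul_le_mul' le_rfl ?_
        rw [lintegral_finsetSum _ fun j _ => by fun_prop]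
        refine Finset.sum_le_sum fun j hj => ?_
        rw [lintegral_const_mul _ (by fun_prop)]
        refine mul_le_mul' le_rfl ?_
        refine setLIntegral_comp_sub_le measurableSet_Icc measurableSet_Ioc (fun t ht => ?_)
          fun t => ‖t‖ₑ ^ (-(1 / 2) : ℝ)
        rw [Finset.mem_Icc] at hj
        have h1 : (-1 : ℝ) ≤ j := by exact_mod_cast hj.1
        have h2 : (j : ℝ) ≤ 3 := by exact_mod_cast hj.2
        exact ⟨by nlinarith [ht.1], by nlinarith [ht.2]⟩

/-! ### Derivatives, their zeros and Mahler measure -/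

/-- Hasse derivatives are Taylor coefficients at `z`, and each shifted factor is `(z - x i) (1 + X /
(z - x i))`. -/
theorem eval_hasseDeriv_monicWithZeros {x : ℕ → ℂ} {n : ℕ} {z : ℂ}
    (hz : ∀ i ∈ Finset.range n, z ≠ x i) (k : ℕ) :
    (hasseDeriv k (monicWithZeros x n)).eval z =
      ratioCoeff x n k z * ∏ i ∈ Finset.range n, (z - x i) := by
  rw [← taylor_coeff, taylor_apply, monicWithZeros, prod_comp, ratioCoeff]
  have h : ∀ i ∈ Finset.range n, (X - C (x i)).comp (X + C z) =
      C (z - x i) * (1 + C ((z - x i)⁻¹) * X) := by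
    intro i hi
    rw [mul_add, mul_one, ← mul_assoc, ← C_mul, mul_inv_cancel₀ (sub_ne_zero.2 (hz i hi)), C_1,
      one_mul, sub_comp, X_comp, C_comp, C_sub]
    ring
  rw [Finset.prod_congr rfl h, Finset.prod_mul_distrib, ← map_prod, coeff_C_mul, mul_comm]

theorem roots_iterate_derivative (Q : ℂ[X]) (k : ℕ) :
    (derivative^[k] Q).roots = (hasseDeriv k Q).roots := by
  rw [← factorial_smul_hasseDeriv, LinearMap.smul_apply, ← Nat.cast_smul_eq_nsmul ℂ,
    roots_smul_nonzero _ (Nat.cast_ne_zero.2 k.factorial_ne_zero)]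

theorem natDegree_hasseDeriv_monicWithZeros (x : ℕ → ℂ) (n k : ℕ) :
    (hasseDeriv k (monicWithZeros x n)).natDegree = n - k := by
  rw [natDegree_hasseDeriv, natDegree_monicWithZeros]

theorem leadingCoeff_hasseDeriv_monicWithZeros (x : ℕ → ℂ) {n k : ℕ} (hkn : k ≤ n) :
    (hasseDeriv k (monicWithZeros x n)).leadingCoeff = n.choose k := by
  have h : (monicWithZeros x n).coeff n = 1 := by
    have := (monic_prod_of_monic (Finset.range n) _ fun i _ => monic_X_sub_C (x i)).coeff_natDegree
    rw [← monicWithZeros, natDegree_monicWithZeros] at this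
    exact this
  rw [leadingCoeff, natDegree_hasseDeriv_monicWithZeros, hasseDeriv_coeff, Nat.sub_add_cancel hkn,
    h, mul_one]

theorem card_roots_hasseDeriv_monicWithZeros (x : ℕ → ℂ) (n k : ℕ) :
    Multiset.card (hasseDeriv k (monicWithZeros x n)).roots = n - k := by
  rw [IsAlgClosed.card_roots_eq_natDegree, natDegree_hasseDeriv_monicWithZeros]

theorem log_norm_multiset_prod {s : Multiset ℂ} (hs : ∀ w ∈ s, w ≠ 0) :
    Real.log ‖s.prod‖ = (s.map fun w => Real.log ‖w‖).sum := by
  induction s using Multiset.induction_on with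
  | empty => simp
  | cons a s ih =>
    have h1 : s.prod ≠ 0 := Multiset.prod_ne_zero fun h =>
      hs 0 (Multiset.mem_cons_of_mem h) rfl
    rw [Multiset.prod_cons, norm_mul, Real.log_mul (norm_ne_zero_iff.2 (hs a (Multiset.mem_cons_self a s)))
      (norm_ne_zero_iff.2 h1), Multiset.map_cons, Multiset.sum_cons,
      ih fun w hw => hs w (Multiset.mem_cons_of_mem hw)]

theorem log_norm_eval_eq {Q : ℂ[X]} (hQ : Q ≠ 0) {z : ℂ} (hz : z ∉ Q.roots) :
    Real.log ‖Q.eval z‖ = Real.log ‖Q.leadingCoeff‖ +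
      (Q.roots.map fun w => Real.log ‖z - w‖).sum := by
  have h : ∀ w ∈ Q.roots.map fun w => z - w, w ≠ 0 := by
    intro w hw
    obtain ⟨v, hv, rfl⟩ := Multiset.mem_map.1 hw
    exact sub_ne_zero.2 fun h => hz (h ▸ hv)
  have h1 : (Q.roots.map fun w => z - w).prod ≠ 0 :=
    Multiset.prod_ne_zero fun h0 => h 0 h0 rfl
  rw [(IsAlgClosed.splits Q).eval_eq_prod_roots, norm_mul,
    Real.log_mul (norm_ne_zero_iff.2 (leadingCoeff_ne_zero.2 hQ)) (norm_ne_zero_iff.2 h1),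
    log_norm_multiset_prod h, Multiset.map_map]
  rfl

theorem hasseDeriv_monicWithZeros_ne_zero (x : ℕ → ℂ) {n k : ℕ} (hkn : k ≤ n) :
    hasseDeriv k (monicWithZeros x n) ≠ 0 := by
  rw [← leadingCoeff_ne_zero, leadingCoeff_hasseDeriv_monicWithZeros x hkn]
  exact Nat.cast_ne_zero.2 (Nat.choose_pos hkn).ne'

/-- The logarithmic potential form of `p⁽ᵏ⁾ / p`. -/
theorem log_norm_ratioCoeff {x : ℕ → ℂ} {n k : ℕ} (hkn : k ≤ n) {z : ℂ}
    (hz : ∀ i ∈ Finset.range n, z ≠ x i) (hz' : z ∉ (hasseDeriv k (monicWithZeros x n)).roots) :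
    Real.log ‖ratioCoeff x n k z‖ = Real.log (n.choose k) +
      ((hasseDeriv k (monicWithZeros x n)).roots.map fun w => Real.log ‖z - w‖).sum -
      ∑ i ∈ Finset.range n, Real.log ‖z - x i‖ := by
  have h0 := hasseDeriv_monicWithZeros_ne_zero x hkn
  have h1 := log_norm_eval_eq h0 hz'
  have hne : ∀ i ∈ Finset.range n, ‖z - x i‖ ≠ 0 := fun i hi =>
    norm_ne_zero_iff.2 (sub_ne_zero.2 (hz i hi))
  have h2 : (hasseDeriv k (monicWithZeros x n)).eval z ≠ 0 := fun h =>
    hz' ((mem_roots h0).2 h)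
  rw [eval_hasseDeriv_monicWithZeros hz] at h1 h2
  rw [norm_mul, norm_prod, Real.log_mul (norm_ne_zero_iff.2 (left_ne_zero_of_mul h2))
    (Finset.prod_ne_zero_iff.2 hne), Real.log_prod hne,
    leadingCoeff_hasseDeriv_monicWithZeros x hkn, Complex.norm_natCast] at h1
  linarith

theorem norm_coeff_monicWithZeros_le (x : ℕ → ℂ) (n j : ℕ) :
    ‖(monicWithZeros x n).coeff j‖ ≤ 2 ^ n * ∏ i ∈ Finset.range n, max 1 ‖x i‖ := by
  have h := norm_coeff_le_choose_mul_mahlerMeasure j (monicWithZeros x n)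
  rw [natDegree_monicWithZeros, mahlerMeasure_eq_leadingCoeff_mul_prod_roots,
    roots_monicWithZeros, Multiset.map_map] at h
  have hlc : (monicWithZeros x n).leadingCoeff = 1 :=
    monic_prod_of_monic _ _ fun i _ => monic_X_sub_C (x i)
  rw [hlc, norm_one, one_mul] at h
  change _ ≤ _ * ∏ i ∈ Finset.range n, max 1 ‖x i‖ at h
  refine h.trans ?_
  have h1 : (n.choose j : ℝ) ≤ 2 ^ n := by exact_mod_cast Nat.choose_le_two_pow n j
  exact mul_le_mul_of_nonneg_right h1
    (Finset.prod_nonneg fun i _ => zero_le_one.trans (le_max_left 1 ‖x i‖))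

/-- The leading coefficient is at least `1` in modulus, so the product of `max 1 ‖w‖` over the zeros
is at most the Mahler measure, hence at most the sum of the coefficients' norms. Each coefficient
carries one `2 ^ n` from the Hasse derivative and one from bounding the coefficients of `p`, which
gives `4 ^ n`. -/
theorem sum_posLog_roots_hasseDeriv_le (x : ℕ → ℂ) {n k : ℕ} (hkn : k ≤ n) :
    ((hasseDeriv k (monicWithZeros x n)).roots.map fun w => Real.posLog ‖w‖).sum ≤
      Real.log (n + 1) + n * Real.log 4 + ∑ i ∈ Finset.range n, Real.posLog ‖x i‖ := by
  set W := hasseDeriv k (monicWithZeros x n) with hW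
  set p : ℝ := ∏ i ∈ Finset.range n, max 1 ‖x i‖ with hp
  have hp0 : 0 < p := Finset.prod_pos fun i _ => lt_max_of_lt_left one_pos
  have h1 : (W.roots.map fun a => max 1 ‖a‖).prod ≤ W.mahlerMeasure := by
    refine prod_max_one_norm_roots_le_mahlerMeasure_of_one_le_leadingCoeff ?_
    rw [leadingCoeff_hasseDeriv_monicWithZeros x hkn, Complex.norm_natCast]
    exact_mod_cast Nat.choose_pos hkn
  have h2 : W.mahlerMeasure ≤ (n + 1) * (4 ^ n * p) := by
    refine (mahlerMeasure_le_sum_norm_coeff W).trans ?_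
    have hdeg : W.natDegree < n + 1 := by
      rw [natDegree_hasseDeriv_monicWithZeros]
      omega
    rw [sum_over_range' W (fun _ => norm_zero) (n + 1) hdeg]
    refine (Finset.sum_le_card_nsmul _ _ (4 ^ n * p) fun j _ => ?_).trans (le_of_eq ?_)
    · rw [hW, hasseDeriv_coeff, norm_mul, Complex.norm_natCast]
      rcases le_or_gt (j + k) n with h | h
      · have h3 : ((j + k).choose k : ℝ) ≤ 2 ^ n := by
          exact_mod_cast (Nat.choose_le_two_pow _ _).trans (Nat.pow_le_pow_right two_pos h)
        have h4 := norm_coeff_monicWithZeros_le x n (j + k)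
        calc ((j + k).choose k : ℝ) * ‖(monicWithZeros x n).coeff (j + k)‖
            ≤ 2 ^ n * (2 ^ n * p) := by gcongr
          _ = 4 ^ n * p := by rw [← mul_assoc, ← mul_pow]; norm_num
      · rw [coeff_eq_zero_of_natDegree_lt (by rwa [natDegree_monicWithZeros]), norm_zero, mul_zero]
        positivity
    · rw [Finset.card_range, nsmul_eq_mul]
      push_cast
      ring
  have h3 : (W.roots.map fun w => Real.posLog ‖w‖).sum =
      Real.log (W.roots.map fun a => max 1 ‖a‖).prod := by
    generalize W.roots = s
    induction s using Multiset.induction_on with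
    | empty => simp
    | cons a s ih =>
      have : (s.map fun a => max 1 ‖a‖).prod ≠ 0 := Multiset.prod_ne_zero fun h => by
        obtain ⟨b, -, hb⟩ := Multiset.mem_map.1 h
        exact (lt_max_of_lt_left one_pos).ne' hb
      rw [Multiset.map_cons, Multiset.sum_cons, Multiset.map_cons, Multiset.prod_cons,
        Real.log_mul (lt_max_of_lt_left one_pos).ne' this, ih,
        Real.posLog_eq_log_max_one (norm_nonneg a)]
  have h4 : Real.log p = ∑ i ∈ Finset.range n, Real.posLog ‖x i‖ := by
    rw [hp, Real.log_prod fun i _ => (lt_max_of_lt_left one_pos).ne']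
    exact Finset.sum_congr rfl fun i _ => (Real.posLog_eq_log_max_one (norm_nonneg _)).symm
  rw [h3, ← h4]
  have h5 : 0 < (W.roots.map fun a => max 1 ‖a‖).prod :=
    one_pos.trans_le (one_le_prod_max_one_norm_roots W)
  refine (Real.log_le_log h5 (h1.trans h2)).trans (le_of_eq ?_)
  rw [Real.log_mul (by positivity) (by positivity), Real.log_mul (by positivity) hp0.ne',
    Real.log_pow, add_assoc]

/-! ### Second moment of `logRatio` -/

theorem abs_log_norm_sub_le (z w : ℂ) : |Real.log ‖z - w‖| ≤
    Real.posLog ‖z‖ + Real.posLog ‖w‖ + Real.log 2 + Real.posLog ‖z - w‖⁻¹ := by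
  have h1 : Real.posLog ‖z - w‖ ≤ Real.posLog ‖z‖ + Real.posLog ‖w‖ + Real.log 2 := by
    have := Real.posLog_norm_add_le z (-w)
    rwa [norm_neg, ← sub_eq_add_neg] at this
  rw [← Real.posLog_sub_posLog_inv, abs_le]
  have h2 := Real.posLog_nonneg (x := ‖z - w‖)
  have h3 := Real.posLog_nonneg (x := ‖z - w‖⁻¹)
  constructor <;> linarith

/-- From `log y ≤ 4 y ^ (1/4)`, with the power chosen so that its square matches the exponent `-1/2`
of the circle estimate. -/
theorem ofReal_posLog_inv_sq_le (v : ℂ) :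
    ENNReal.ofReal (Real.posLog ‖v‖⁻¹ ^ 2) ≤ 16 * ‖v‖ₑ ^ (-(1 / 2) : ℝ) := by
  rcases eq_or_ne v 0 with rfl | hv
  · simp
  have hv' : 0 < ‖v‖ := norm_pos_iff.2 hv
  have h1 : Real.posLog ‖v‖⁻¹ ≤ 4 * ‖v‖⁻¹ ^ (1 / 4 : ℝ) := by
    rw [Real.posLog_apply]
    refine max_le (by positivity) ((Real.log_le_rpow_div (by positivity)
      (show (0 : ℝ) < 1 / 4 by norm_num)).trans (le_of_eq ?_))
    ring
  have h2 : (4 * ‖v‖⁻¹ ^ (1 / 4 : ℝ)) ^ 2 = 16 * ‖v‖ ^ (-(1 / 2) : ℝ) := by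
    rw [mul_pow, ← Real.rpow_natCast (‖v‖⁻¹ ^ (1 / 4 : ℝ)), ← Real.rpow_mul (by positivity),
      Real.inv_rpow hv'.le, ← Real.rpow_neg hv'.le]
    norm_num
  calc ENNReal.ofReal (Real.posLog ‖v‖⁻¹ ^ 2)
      ≤ ENNReal.ofReal (16 * ‖v‖ ^ (-(1 / 2) : ℝ)) := by
        rw [← h2]
        exact ENNReal.ofReal_le_ofReal (pow_le_pow_left₀ Real.posLog_nonneg h1 2)
    _ = 16 * ‖v‖ₑ ^ (-(1 / 2) : ℝ) := by
        rw [ENNReal.ofReal_mul (by norm_num), ← ofReal_norm, ENNReal.ofReal_rpow_of_pos hv']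
        norm_num

theorem sq_multiset_sum_map_le (s : Multiset ℂ) (f : ℂ → ℝ) :
    (s.map f).sum ^ 2 ≤ Multiset.card s * (s.map fun w => f w ^ 2).sum := by
  classical
  have h := sq_sum_le_card_mul_sum_sq (s := (Finset.univ : Finset s)) (f := fun w => f w.1)
  rw [Finset.card_univ, Multiset.card_coe] at h
  have h1 := congrArg Multiset.sum (Multiset.map_univ s f)
  have h2 := congrArg Multiset.sum (Multiset.map_univ s fun w => f w ^ 2)
  rw [← h1, ← h2]
  exact h

theorem ofReal_multiset_sum_le {s : Multiset ℂ} {f : ℂ → ℝ} {g : ℂ → ℝ≥0∞}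
    (h : ∀ w, ENNReal.ofReal (f w) ≤ g w) : ENNReal.ofReal (s.map f).sum ≤ (s.map g).sum := by
  induction s using Multiset.induction_on with
  | empty => simp
  | cons a s ih =>
    rw [Multiset.map_cons, Multiset.sum_cons, Multiset.map_cons, Multiset.sum_cons]
    exact ENNReal.ofReal_add_le.trans (add_le_add (h a) ih)

/-- `(1 / n) log |p⁽ᵏ⁾ / (k! p)|` for the monic polynomial with zeros `x 0, …, x (n - 1)`. -/
noncomputable def logRatio (x : ℕ → ℂ) (n k : ℕ) (z : ℂ) : ℝ :=
  (1 / (n : ℝ)) * Real.log ‖ratioCoeff x n k z‖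

theorem measurable_ratioCoeff (x : ℕ → ℂ) (n k : ℕ) : Measurable (ratioCoeff x n k) :=
  measurable_coeff_prod (Finset.range n) (u := fun i z => (z - x i)⁻¹) (fun i => by fun_prop) k

theorem measurable_logRatio (x : ℕ → ℂ) (n k : ℕ) : Measurable (logRatio x n k) :=
  (Real.measurable_log.comp (measurable_ratioCoeff x n k).norm).const_mul _

theorem ae_ne_of_lintegral_le {ρ : Measure ℂ} {K : ℝ≥0∞} (hKtop : K ≠ ∞)
    (hK : ∀ w, ∫⁻ z, ‖z - w‖ₑ ^ (-(1 / 2) : ℝ) ∂ρ ≤ K) (w : ℂ) : ∀ᵐ z ∂ρ, z ≠ w := by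
  have hm : Measurable fun z : ℂ => ‖z - w‖ₑ ^ (-(1 / 2) : ℝ) := by fun_prop
  filter_upwards [ae_lt_top hm (ne_top_of_le_ne_top hKtop (hK w))] with z hz h
  rw [h, sub_self, enorm_zero, ENNReal.zero_rpow_of_neg (by norm_num)] at hz
  exact lt_irrefl _ hz

theorem ae_log_norm_ratioCoeff {ρ : Measure ℂ} {K : ℝ≥0∞} (hKtop : K ≠ ∞)
    (hK : ∀ w, ∫⁻ z, ‖z - w‖ₑ ^ (-(1 / 2) : ℝ) ∂ρ ≤ K) (x : ℕ → ℂ) {n k : ℕ} (hkn : k ≤ n) :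
    ∀ᵐ z ∂ρ, Real.log ‖ratioCoeff x n k z‖ = Real.log (n.choose k) +
      ((hasseDeriv k (monicWithZeros x n)).roots.map fun w => Real.log ‖z - w‖).sum -
      ∑ i ∈ Finset.range n, Real.log ‖z - x i‖ := by
  have h1 : ∀ᵐ z ∂ρ, ∀ i, z ≠ x i := ae_all_iff.2 fun i => ae_ne_of_lintegral_le hKtop hK (x i)
  have h2 : ∀ᵐ z ∂ρ, ∀ w ∈ (hasseDeriv k (monicWithZeros x n)).roots.toFinset, z ≠ w :=
    (Finset.eventually_all _).2 fun w _ => ae_ne_of_lintegral_le hKtop hK w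
  filter_upwards [h1, h2] with z h1 h2
  exact log_norm_ratioCoeff hkn (fun i _ => h1 i) fun h => h2 z (Multiset.mem_toFinset.2 h) rfl

theorem lintegral_multiset_sum_le {ρ : Measure ℂ} {K : ℝ≥0∞}
    (hK : ∀ w, ∫⁻ z, ‖z - w‖ₑ ^ (-(1 / 2) : ℝ) ∂ρ ≤ K) (s : Multiset ℂ) :
    ∫⁻ z, (s.map fun w => ‖z - w‖ₑ ^ (-(1 / 2) : ℝ)).sum ∂ρ ≤ Multiset.card s * K := by
  induction s using Multiset.induction_on with
  | empty => simp
  | cons a s ih =>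
    simp only [Multiset.map_cons, Multiset.sum_cons, Multiset.card_cons]
    rw [lintegral_add_left (by fun_prop)]
    push_cast
    rw [add_mul, one_mul, add_comm]
    exact add_le_add ih (hK a)

theorem abs_multiset_sum_map_le (s : Multiset ℂ) {f g : ℂ → ℝ} (h : ∀ w, |f w| ≤ g w) :
    |(s.map f).sum| ≤ (s.map g).sum := by
  induction s using Multiset.induction_on with
  | empty => simp
  | cons a s ih =>
    rw [Multiset.map_cons, Multiset.sum_cons, Multiset.map_cons, Multiset.sum_cons]
    exact (abs_add_le _ _).trans (add_le_add (h a) ih)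

/-- A uniform `L²` bound for `logRatio`. -/
theorem lintegral_logRatio_sq_le {ρ : Measure ℂ} [IsProbabilityMeasure ρ] {K : ℝ≥0∞}
    (hKtop : K ≠ ∞) (hK : ∀ w, ∫⁻ z, ‖z - w‖ₑ ^ (-(1 / 2) : ℝ) ∂ρ ≤ K) {R : ℝ}
    (hR : ∀ᵐ z ∂ρ, ‖z‖ ≤ R) {x : ℕ → ℂ} {n k : ℕ} (hn : 0 < n) (hkn : k ≤ n) {A : ℝ}
    (hA : (1 / (n : ℝ)) * ∑ i ∈ Finset.range n, Real.posLog ‖x i‖ ≤ A) :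
    ∫⁻ z, ENNReal.ofReal (logRatio x n k z ^ 2) ∂ρ ≤
      ENNReal.ofReal (2 * (Real.log 2 + 2 * (Real.posLog R + Real.log 2) +
        (1 + Real.log 4 + 2 * A)) ^ 2) + 128 * K := by
  have hn' : (0 : ℝ) < n := by exact_mod_cast hn
  set roots := (hasseDeriv k (monicWithZeros x n)).roots with hroots
  -- All singularities of `log ‖ratioCoeff‖`, from numerator and denominator, are treated together;
  -- there are at most `2 * n`.
  set m : Multiset ℂ := roots + (Multiset.range n).map x with hm
  have hcard : Multiset.card m ≤ 2 * n := by
    rw [hm, Multiset.card_add, card_roots_hasseDeriv_monicWithZeros, Multiset.card_map,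
      Multiset.card_range]
    omega
  have hcard' : (Multiset.card m : ℝ) ≤ 2 * n := by exact_mod_cast hcard
  set A' : ℝ := Real.log 2 + 2 * (Real.posLog R + Real.log 2) + (1 + Real.log 4 + 2 * A) with hA'
  have hsumm : ∀ f : ℂ → ℝ, (m.map f).sum = (roots.map f).sum + ∑ i ∈ Finset.range n, f (x i) := by
    intro f
    rw [hm, Multiset.map_add, Multiset.sum_add, Multiset.map_map]
    rfl
  have hlog2 : 0 ≤ Real.log 2 := Real.log_nonneg one_le_two
  have hAn : ∑ i ∈ Finset.range n, Real.posLog ‖x i‖ ≤ n * A := by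
    rwa [one_div, inv_mul_le_iff₀ hn'] at hA
  have hposLog : (m.map fun w => Real.posLog ‖w‖).sum ≤ n * (1 + Real.log 4 + 2 * A) := by
    rw [hsumm]
    have h1 := sum_posLog_roots_hasseDeriv_le x hkn
    have h2 : Real.log (n + 1) ≤ n := by
      have := Real.log_le_sub_one_of_pos (show (0 : ℝ) < n + 1 by positivity)
      linarith
    rw [← hroots] at h1
    linarith
  have hpt : ∀ᵐ z ∂ρ, ENNReal.ofReal (logRatio x n k z ^ 2) ≤ ENNReal.ofReal (2 * A' ^ 2) +
      ENNReal.ofReal (4 / n) * (16 * (m.map fun w => ‖z - w‖ₑ ^ (-(1 / 2) : ℝ)).sum) := by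
    filter_upwards [hR, ae_log_norm_ratioCoeff hKtop hK x hkn] with z hzR hz
    set G := (m.map fun w => Real.posLog ‖z - w‖⁻¹).sum with hG
    have habs : |Real.log ‖ratioCoeff x n k z‖| ≤ n * A' + G := by
      have h1 : |Real.log (n.choose k)| ≤ n * Real.log 2 := by
        have hc : (1 : ℝ) ≤ n.choose k := by exact_mod_cast Nat.choose_pos hkn
        rw [abs_of_nonneg (Real.log_nonneg hc), ← Real.log_pow]
        refine Real.log_le_log (by linarith) ?_
        exact_mod_cast Nat.choose_le_two_pow n k
      have h2 : |(roots.map fun w => Real.log ‖z - w‖).sum| +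
          |∑ i ∈ Finset.range n, Real.log ‖z - x i‖| ≤ (m.map fun w => |Real.log ‖z - w‖|).sum := by
        rw [hsumm]
        exact add_le_add (abs_multiset_sum_map_le _ fun w => le_rfl) (Finset.abs_sum_le_sum_abs _ _)
      have h3 : (m.map fun w => |Real.log ‖z - w‖|).sum ≤ (m.map fun w =>
          (Real.posLog R + Real.log 2) + Real.posLog ‖w‖ + Real.posLog ‖z - w‖⁻¹).sum := by
        refine Multiset.sum_map_le_sum_map _ _ fun w _ => ?_
        have h4 := abs_log_norm_sub_le z w
        have h5 := Real.posLog_le_posLog (norm_nonneg z) hzR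
        linarith
      rw [Multiset.sum_map_add, Multiset.sum_map_add, Multiset.map_const', Multiset.sum_replicate,
        nsmul_eq_mul] at h3
      have h6 : (Multiset.card m : ℝ) * (Real.posLog R + Real.log 2) ≤
          2 * n * (Real.posLog R + Real.log 2) :=
        mul_le_mul_of_nonneg_right hcard' (add_nonneg Real.posLog_nonneg hlog2)
      rw [hz]
      refine (abs_sub _ _).trans ((add_le_add_left (abs_add_le _ _) _).trans ?_)
      rw [hA', hG]
      linarith
    have hsq : logRatio x n k z ^ 2 ≤ 2 * A' ^ 2 +
        4 / n * (m.map fun w => Real.posLog ‖z - w‖⁻¹ ^ 2).sum := by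
      have h1 : |logRatio x n k z| ≤ A' + G / n := by
        rw [logRatio, abs_mul, abs_of_nonneg (by positivity), one_div, inv_mul_le_iff₀ hn', mul_add,
          mul_div_cancel₀ _ hn'.ne']
        exact habs
      -- Cauchy–Schwarz over at most `2 * n` points; after division by `n²` the remaining `1 / n` is
      -- compensated by the number of terms, so the bound is free of `n`.
      have h2 := sq_multiset_sum_map_le m fun w => Real.posLog ‖z - w‖⁻¹
      rw [← hG] at h2
      set Q := (m.map fun w => Real.posLog ‖z - w‖⁻¹ ^ 2).sum with hQ
      have hQ0 : 0 ≤ Q := Multiset.sum_nonneg fun y hy => by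
        obtain ⟨w, -, rfl⟩ := Multiset.mem_map.1 hy
        positivity
      have h3 : G ^ 2 ≤ 2 * n * Q := h2.trans (mul_le_mul_of_nonneg_right hcard' hQ0)
      have h4 : (G / n) ^ 2 ≤ 2 / n * Q := by
        rw [div_pow, div_le_iff₀ (by positivity)]
        refine h3.trans (le_of_eq ?_)
        field_simp
      calc logRatio x n k z ^ 2 = |logRatio x n k z| ^ 2 := (sq_abs _).symm
        _ ≤ (A' + G / n) ^ 2 := pow_le_pow_left₀ (abs_nonneg _) h1 2
        _ ≤ 2 * A' ^ 2 + 2 * (G / n) ^ 2 := by nlinarith [sq_nonneg (A' - G / n)]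
        _ ≤ 2 * A' ^ 2 + 2 * (2 / n * Q) := by gcongr
        _ = 2 * A' ^ 2 + 4 / n * Q := by ring
    refine (ENNReal.ofReal_le_ofReal hsq).trans (ENNReal.ofReal_add_le.trans ?_)
    rw [ENNReal.ofReal_mul (p := 4 / n) (by positivity),
      show ∀ f : ℂ → ℝ≥0∞, 16 * (m.map f).sum = (m.map fun w => 16 * f w).sum from fun f =>
        Multiset.sum_map_mul_left.symm]
    exact add_le_add le_rfl (mul_le_mul' le_rfl
      (ofReal_multiset_sum_le fun w => ofReal_posLog_inv_sq_le (z - w)))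
  refine (lintegral_mono_ae hpt).trans ?_
  rw [lintegral_add_left measurable_const, lintegral_const, measure_univ, mul_one,
    lintegral_const_mul' _ _ ENNReal.ofReal_ne_top, lintegral_const_mul' _ _ (by simp)]
  refine add_le_add le_rfl ?_
  have h1 := lintegral_multiset_sum_le hK m
  calc ENNReal.ofReal (4 / n) * (16 * ∫⁻ z, (m.map fun w => ‖z - w‖ₑ ^ (-(1 / 2) : ℝ)).sum ∂ρ)
      ≤ ENNReal.ofReal (4 / n) * (16 * (ENNReal.ofReal (2 * n) * K)) := by
        gcongr
        refine h1.trans ?_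
        gcongr
        rw [← ENNReal.ofReal_natCast]
        exact ENNReal.ofReal_le_ofReal hcard'
    _ = ENNReal.ofReal (4 / n * (16 * (2 * n))) * K := by
        rw [ENNReal.ofReal_mul (p := 4 / n) (by positivity),
          ENNReal.ofReal_mul (p := 16) (q := 2 * n) (by norm_num), ENNReal.ofReal_ofNat]
        ring
    _ = 128 * K := by
        have : (4 / n * (16 * (2 * n)) : ℝ) = 128 := by
          field_simp
          norm_num
        rw [this, ENNReal.ofReal_ofNat]

/-! ### Large values of `ratioCoeff` -/

/-- Square roots `q i` enter because only `‖z - w‖ ^ (-1/2)` has a usable first moment; Markov's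
inequality is later applied to their sum rather than to the coefficient. -/
theorem enorm_coeff_prod_le (s : Finset ℕ) {u : ℕ → ℂ} {q : ℕ → ℝ≥0∞} (h : ∀ i, ‖u i‖ₑ ≤ q i ^ 2)
    (k : ℕ) : ‖(∏ i ∈ s, (1 + C (u i) * X)).coeff k‖ₑ ≤ (∑ i ∈ s, q i) ^ (2 * k) := by
  induction s using Finset.induction_on generalizing k with
  | empty =>
    cases k with
    | zero => simp
    | succ k => simp [coeff_one]
  | insert a s ha ih =>
    cases k with
    | zero => simp [coeff_zero_prod_one_add]
    | succ k =>
      rw [Finset.prod_insert ha, Finset.sum_insert ha, add_mul, one_mul, coeff_add, mul_assoc,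
        coeff_C_mul, coeff_X_mul]
      set Q := ∑ i ∈ s, q i with hQ
      calc ‖(∏ i ∈ s, (1 + C (u i) * X)).coeff (k + 1) +
            u a * (∏ i ∈ s, (1 + C (u i) * X)).coeff k‖ₑ
          ≤ Q ^ (2 * (k + 1)) + q a ^ 2 * Q ^ (2 * k) := by
            refine (enorm_add_le _ _).trans (add_le_add (ih (k + 1)) ?_)
            rw [enorm_mul]
            exact mul_le_mul' (h a) (ih k)
        _ = Q ^ (2 * k) * (Q ^ 2 + q a ^ 2) := by ring
        _ ≤ (q a + Q) ^ (2 * k) * (q a + Q) ^ 2 := by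
            refine mul_le_mul' (pow_le_pow_left₀ zero_le le_add_self _) ?_
            rw [add_sq, add_comm (Q ^ 2), add_assoc]
            refine add_le_add le_rfl ?_
            exact le_add_self
        _ = (q a + Q) ^ (2 * (k + 1)) := by ring

theorem enorm_inv_le_rpow_sq (v : ℂ) : ‖v⁻¹‖ₑ ≤ (‖v‖ₑ ^ (-(1 / 2) : ℝ)) ^ 2 := by
  rcases eq_or_ne v 0 with rfl | hv
  · simp
  · rw [enorm_inv hv, ← ENNReal.rpow_natCast, ← ENNReal.rpow_mul]
    norm_num
    rw [ENNReal.rpow_neg_one]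

/-- A uniform upper tail bound for `ratioCoeff`. -/
theorem measure_exp_le_ratioCoeff {ρ : Measure ℂ} {K : ℝ≥0∞}
    (hK : ∀ w, ∫⁻ z, ‖z - w‖ₑ ^ (-(1 / 2) : ℝ) ∂ρ ≤ K) (x : ℕ → ℂ) (n : ℕ) {k : ℕ} (hk : 1 ≤ k)
    (t : ℝ) : ρ {z | Real.exp t ≤ ‖ratioCoeff x n k z‖} ≤
      n * K / ENNReal.ofReal (Real.exp (t / (2 * k))) := by
  set q : ℂ → ℝ≥0∞ := fun z => ∑ i ∈ Finset.range n, ‖z - x i‖ₑ ^ (-(1 / 2) : ℝ) with hq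
  have hqm : Measurable q := by fun_prop
  have hk' : (0 : ℝ) < k := by exact_mod_cast hk
  have hsub : {z | Real.exp t ≤ ‖ratioCoeff x n k z‖} ⊆
      {z | ENNReal.ofReal (Real.exp (t / (2 * k))) ≤ q z} := by
    intro z hz
    by_contra hcon
    have h1 : q z < ENNReal.ofReal (Real.exp (t / (2 * k))) := not_le.1 hcon
    have h2 : ‖ratioCoeff x n k z‖ₑ ≤ q z ^ (2 * k) :=
      enorm_coeff_prod_le _ (fun i => enorm_inv_le_rpow_sq (z - x i)) k
    have h3 := ENNReal.pow_lt_pow_left (n := 2 * k) (by omega) h1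
    rw [← ENNReal.ofReal_pow (Real.exp_pos _).le, ← Real.exp_nat_mul] at h3
    have e : ((2 * k : ℕ) : ℝ) * (t / (2 * k)) = t := by
      push_cast
      field_simp
    rw [e] at h3
    have h4 := h2.trans_lt h3
    rw [← ofReal_norm] at h4
    exact absurd (ENNReal.ofReal_le_ofReal hz) (not_le.2 h4)
  refine (measure_mono hsub).trans ((meas_ge_le_lintegral_div hqm.aemeasurable
    (by simpa using Real.exp_pos _) ENNReal.ofReal_ne_top).trans ?_)
  refine ENNReal.div_le_div_right ?_ _
  rw [hq, lintegral_finsetSum _ fun i _ => by fun_prop]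
  refine (Finset.sum_le_card_nsmul _ _ K fun i _ => hK (x i)).trans (le_of_eq ?_)
  rw [Finset.card_range, nsmul_eq_mul]

theorem tendsto_nat_mul_div_exp {K : ℝ≥0∞} (hKtop : K ≠ ∞) {ε : ℝ} (hε : 0 < ε) {k : ℕ}
    (hk : 1 ≤ k) : Tendsto (fun n : ℕ => n * K / ENNReal.ofReal (Real.exp (ε * n / (2 * k))))
      atTop (𝓝 0) := by
  have hk' : (0 : ℝ) < k := by exact_mod_cast hk
  have h1 : Tendsto (fun n : ℕ => K.toReal * (2 * k / ε) * ((ε / (2 * k) * n) ^ 1 *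
      Real.exp (-(ε / (2 * k) * n)))) atTop (𝓝 (K.toReal * (2 * k / ε) * 0)) := by
    refine Tendsto.const_mul _ ((Real.tendsto_pow_mul_exp_neg_atTop_nhds_zero 1).comp ?_)
    exact tendsto_natCast_atTop_atTop.const_mul_atTop (by positivity)
  rw [mul_zero] at h1
  have h2 := ENNReal.tendsto_ofReal h1
  rw [ENNReal.ofReal_zero] at h2
  refine h2.congr fun n => ?_
  nth_rewrite 2 [← ENNReal.ofReal_toReal hKtop]
  rw [← ENNReal.ofReal_natCast, ← ENNReal.ofReal_mul (by positivity),
    ← ENNReal.ofReal_div_of_pos (Real.exp_pos _)]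
  congr 1
  rw [Real.exp_neg, pow_one]
  have : ε / (2 * k) * n = ε * n / (2 * k) := by ring
  rw [this]
  field_simp

/-! ### Mean convergence of `logRatio` -/

/-- Where `|logRatio|` exceeds `ε`, the ratio is exponentially large or small, and `2 l ≤ δ l² +
δ⁻¹` trades the excess for the second moment and the measure of these two sets. A vanishing ratio is
harmless, since `Real.log 0 = 0`. -/
theorem ofReal_abs_logRatio_le (x : ℕ → ℂ) {n : ℕ} (hn : 0 < n) (k : ℕ) {ε δ : ℝ} (hε : 0 < ε)
    (hδ : 0 < δ) (z : ℂ) : ENNReal.ofReal |logRatio x n k z| ≤ ENNReal.ofReal ε +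
      (ENNReal.ofReal δ * ENNReal.ofReal (logRatio x n k z ^ 2) + ENNReal.ofReal δ⁻¹ *
        ({z | Real.exp (ε * n) ≤ ‖ratioCoeff x n k z‖}.indicator 1 z +
          {z | ‖ratioCoeff x n k z‖ ≤ Real.exp (-(ε * n))}.indicator 1 z)) := by
  have hn' : (0 : ℝ) < n := by exact_mod_cast hn
  rcases le_or_gt |logRatio x n k z| ε with h | h
  · exact (ENNReal.ofReal_le_ofReal h).trans le_self_add
  have h1 : |logRatio x n k z| ≤ δ * logRatio x n k z ^ 2 + δ⁻¹ := by
    rw [← sq_abs]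
    set l := |logRatio x n k z|
    have h2 : 0 ≤ δ⁻¹ * (δ * l - 1) ^ 2 := by positivity
    have h3 : δ⁻¹ * (δ * l - 1) ^ 2 = δ * l ^ 2 - 2 * l + δ⁻¹ := by
      field_simp
      ring
    have h4 : 0 ≤ l := abs_nonneg _
    linarith
  have h2 : (1 : ℝ≥0∞) ≤ {z | Real.exp (ε * n) ≤ ‖ratioCoeff x n k z‖}.indicator 1 z +
      {z | ‖ratioCoeff x n k z‖ ≤ Real.exp (-(ε * n))}.indicator 1 z := by
    have h3 : ε * n < |Real.log ‖ratioCoeff x n k z‖| := by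
      rw [logRatio, abs_mul, abs_of_pos (by positivity), one_div, lt_inv_mul_iff₀ hn'] at h
      linarith
    have hpos : 0 < ‖ratioCoeff x n k z‖ := by
      rcases (norm_nonneg (ratioCoeff x n k z)).eq_or_lt with h0 | h0
      · rw [← h0, Real.log_zero, abs_zero] at h3
        have : 0 < ε * n := by positivity
        linarith
      · exact h0
    rcases lt_abs.1 h3 with h4 | h4
    · have : z ∈ {z | Real.exp (ε * n) ≤ ‖ratioCoeff x n k z‖} :=
        ((Real.lt_log_iff_exp_lt hpos).1 h4).le
      rw [Set.indicator_of_mem this]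
      exact le_self_add
    · have : z ∈ {z | ‖ratioCoeff x n k z‖ ≤ Real.exp (-(ε * n))} :=
        ((Real.log_lt_iff_lt_exp hpos).1 (by linarith)).le
      rw [Set.indicator_of_mem this]
      exact le_add_self
  refine (ENNReal.ofReal_le_ofReal h1).trans (ENNReal.ofReal_add_le.trans ?_)
  rw [ENNReal.ofReal_mul hδ.le]
  refine le_add_left (add_le_add le_rfl ?_)
  exact (mul_one _).ge.trans (mul_le_mul' le_rfl h2)

theorem lintegral_abs_logRatio_le {ρ : Measure ℂ} [IsProbabilityMeasure ρ] (x : ℕ → ℂ) {n : ℕ}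
    (hn : 0 < n) (k : ℕ) {ε δ : ℝ} (hε : 0 < ε) (hδ : 0 < δ) :
    ∫⁻ z, ENNReal.ofReal |logRatio x n k z| ∂ρ ≤ ENNReal.ofReal ε +
      (ENNReal.ofReal δ * ∫⁻ z, ENNReal.ofReal (logRatio x n k z ^ 2) ∂ρ + ENNReal.ofReal δ⁻¹ *
        (ρ {z | Real.exp (ε * n) ≤ ‖ratioCoeff x n k z‖} +
          ρ {z | ‖ratioCoeff x n k z‖ ≤ Real.exp (-(ε * n))})) := by
  have hm1 : MeasurableSet {z | Real.exp (ε * n) ≤ ‖ratioCoeff x n k z‖} :=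
    measurableSet_le measurable_const (measurable_ratioCoeff x n k).norm
  have hm2 : MeasurableSet {z | ‖ratioCoeff x n k z‖ ≤ Real.exp (-(ε * n))} :=
    measurableSet_le (measurable_ratioCoeff x n k).norm measurable_const
  have hm3 : Measurable fun z => ENNReal.ofReal (logRatio x n k z ^ 2) :=
    ((measurable_logRatio x n k).pow_const 2).ennreal_ofReal
  refine (lintegral_mono fun z => ofReal_abs_logRatio_le x hn k hε hδ z).trans (le_of_eq ?_)
  rw [lintegral_add_left measurable_const, lintegral_const, measure_univ, mul_one,
    lintegral_add_left (hm3.const_mul _), lintegral_const_mul _ hm3,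
    lintegral_const_mul' _ _ ENNReal.ofReal_ne_top,
    lintegral_add_left (measurable_one.indicator hm1), lintegral_indicator_one hm1,
    lintegral_indicator_one hm2]

theorem measurable_uncurry_ratioCoeff {Ω : Type*} [MeasurableSpace Ω] {ξ : ℕ → Ω → ℂ}
    (hξ_meas : ∀ i, Measurable (ξ i)) (n k : ℕ) :
    Measurable fun p : Ω × ℂ => ratioCoeff (fun i => ξ i p.1) n k p.2 :=
  measurable_coeff_prod (Finset.range n) (u := fun i (p : Ω × ℂ) => (p.2 - ξ i p.1)⁻¹)
    (fun i => (measurable_snd.sub ((hξ_meas i).comp measurable_fst)).fun_inv) k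

/-- Fubini turns this into an average over `z` of probabilities that tend to zero for every fixed
`z`, and these are bounded by `1`. -/
theorem tendsto_lintegral_measure_ratioCoeff_le {Ω : Type*} [MeasurableSpace Ω] {P : Measure Ω}
    [IsProbabilityMeasure P] {a b : ℕ → ℂ} (hab : {i : ℕ | a i ≠ b i}.Infinite)
    {ξ : ℕ → Ω → ℂ} (hξ_meas : ∀ i, Measurable (ξ i)) (hξ_indep : iIndepFun ξ P)
    (hξ_law : ∀ i, P.map (ξ i) =
      (2⁻¹ : ℝ≥0∞) • Measure.dirac (a i) + (2⁻¹ : ℝ≥0∞) • Measure.dirac (b i))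
    (ρ : Measure ℂ) [IsProbabilityMeasure ρ] (k : ℕ) {ε : ℝ} (hε : 0 < ε) :
    Tendsto (fun n : ℕ =>
      ∫⁻ ω, ρ {z | ‖ratioCoeff (fun i => ξ i ω) n k z‖ ≤ Real.exp (-(ε * n))} ∂P)
      atTop (𝓝 0) := by
  set S : ℕ → Set (Ω × ℂ) := fun n =>
    {p | ‖ratioCoeff (fun i => ξ i p.1) n k p.2‖ ≤ Real.exp (-(ε * n))} with hS
  have hSm : ∀ n, MeasurableSet (S n) := fun n =>
    measurableSet_le (measurable_uncurry_ratioCoeff hξ_meas n k).norm measurable_const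
  have h1 : ∀ n : ℕ,
      ∫⁻ ω, ρ {z | ‖ratioCoeff (fun i => ξ i ω) n k z‖ ≤ Real.exp (-(ε * n))} ∂P =
      ∫⁻ z, P {ω | ‖ratioCoeff (fun i => ξ i ω) n k z‖ ≤ Real.exp (-(ε * n))} ∂ρ := fun n =>
    (Measure.prod_apply (μ := P) (ν := ρ) (hSm n)).symm.trans (Measure.prod_apply_symm (hSm n))
  simp_rw [h1]
  have h2 : Tendsto (fun n : ℕ =>
      ∫⁻ z, P {ω | ‖ratioCoeff (fun i => ξ i ω) n k z‖ ≤ Real.exp (-(ε * n))} ∂ρ) atTop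
      (𝓝 (∫⁻ _, 0 ∂ρ)) := by
    refine tendsto_lintegral_of_dominated_convergence (fun _ => 1)
      (fun n => measurable_measure_prodMk_right (hSm n)) (fun n => ae_of_all _ fun z => prob_le_one)
      (by simp) (ae_of_all _ fun z => ?_)
    exact tendsto_measure_ratioCoeff_le hab hξ_meas hξ_indep hξ_law k hε
  simpa using h2

theorem tendsto_lintegral_logRatio {Ω : Type*} [MeasurableSpace Ω] {P : Measure Ω}
    [IsProbabilityMeasure P] {a b : ℕ → ℂ} (hab : {i : ℕ | a i ≠ b i}.Infinite)
    {ξ : ℕ → Ω → ℂ} (hξ_meas : ∀ i, Measurable (ξ i)) (hξ_indep : iIndepFun ξ P)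
    (hξ_law : ∀ i, P.map (ξ i) =
      (2⁻¹ : ℝ≥0∞) • Measure.dirac (a i) + (2⁻¹ : ℝ≥0∞) • Measure.dirac (b i))
    {ρ : Measure ℂ} [IsProbabilityMeasure ρ] {K : ℝ≥0∞}
    (hKtop : K ≠ ∞) (hK : ∀ w, ∫⁻ z, ‖z - w‖ₑ ^ (-(1 / 2) : ℝ) ∂ρ ≤ K) {R : ℝ}
    (hR : ∀ᵐ z ∂ρ, ‖z‖ ≤ R) {A : ℝ} (hA : ∀ᵐ ω ∂P, ∀ n : ℕ, 1 ≤ n →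
      (1 / (n : ℝ)) * ∑ i ∈ Finset.range n, Real.posLog ‖ξ i ω‖ ≤ A) {k : ℕ} (hk : 1 ≤ k) :
    Tendsto (fun n : ℕ =>
      ∫⁻ ω, ∫⁻ z, ENNReal.ofReal |logRatio (fun i => ξ i ω) n k z| ∂ρ ∂P) atTop (𝓝 0) := by
  set B : ℝ≥0∞ := ENNReal.ofReal (2 * (Real.log 2 + 2 * (Real.posLog R + Real.log 2) +
        (1 + Real.log 4 + 2 * A)) ^ 2) + 128 * K with hB
  have hBtop : B ≠ ∞ :=
    ENNReal.add_ne_top.2 ⟨ENNReal.ofReal_ne_top, ENNReal.mul_ne_top (by simp) hKtop⟩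
  rw [ENNReal.tendsto_nhds_zero]
  intro η' hη'
  obtain ⟨η, hη0, hηle⟩ : ∃ η : ℝ, 0 < η ∧ ENNReal.ofReal η ≤ η' := by
    rcases eq_or_ne η' ∞ with rfl | h
    · exact ⟨1, one_pos, le_top⟩
    · exact ⟨η'.toReal, ENNReal.toReal_pos hη'.ne' h, ENNReal.ofReal_toReal_le⟩
  -- `ε` and `δ` are fixed before `n`, costing `η / 4` each; the factor `δ⁻¹` is then a constant,
  -- beaten by the two tail terms for large `n`.
  set ε : ℝ := η / 4 with hεdef
  set δ : ℝ := η / (4 * (B.toReal + 1)) with hδdef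
  have hB0 : 0 ≤ B.toReal := ENNReal.toReal_nonneg
  have hε : 0 < ε := by positivity
  have hδ : 0 < δ := by positivity
  have hδB : ENNReal.ofReal δ * B ≤ ENNReal.ofReal (η / 4) := by
    nth_rewrite 1 [← ENNReal.ofReal_toReal hBtop]
    rw [← ENNReal.ofReal_mul hδ.le]
    refine ENNReal.ofReal_le_ofReal ?_
    rw [hδdef, div_mul_eq_mul_div, div_le_div_iff₀ (by positivity) (by positivity)]
    nlinarith
  have hlim : Tendsto (fun n : ℕ => ENNReal.ofReal δ⁻¹ *
      (n * K / ENNReal.ofReal (Real.exp (ε * n / (2 * k))) +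
        ∫⁻ ω, ρ {z | ‖ratioCoeff (fun i => ξ i ω) n k z‖ ≤ Real.exp (-(ε * n))} ∂P))
      atTop (𝓝 0) := by
    have h1 := (tendsto_nat_mul_div_exp hKtop hε hk).add
      (tendsto_lintegral_measure_ratioCoeff_le hab hξ_meas hξ_indep hξ_law ρ k hε)
    have h2 := ENNReal.Tendsto.const_mul (a := ENNReal.ofReal δ⁻¹) h1
      (Or.inr ENNReal.ofReal_ne_top)
    simpa using h2
  filter_upwards [(ENNReal.tendsto_nhds_zero.1 hlim) (ENNReal.ofReal (η / 2))
    (ENNReal.ofReal_pos.2 (by positivity)), eventually_ge_atTop k] with n hn hkn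
  have hn0 : 0 < n := by omega
  calc ∫⁻ ω, ∫⁻ z, ENNReal.ofReal |logRatio (fun i => ξ i ω) n k z| ∂ρ ∂P
      ≤ ∫⁻ ω, (ENNReal.ofReal ε + ENNReal.ofReal δ * B + ENNReal.ofReal δ⁻¹ *
          (n * K / ENNReal.ofReal (Real.exp (ε * n / (2 * k))) +
            ρ {z | ‖ratioCoeff (fun i => ξ i ω) n k z‖ ≤ Real.exp (-(ε * n))})) ∂P := by
        refine lintegral_mono_ae ?_
        filter_upwards [hA] with ω hω
        refine (lintegral_abs_logRatio_le _ hn0 k hε hδ).trans ?_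
        rw [← add_assoc]
        gcongr
        · exact lintegral_logRatio_sq_le hKtop hK hR hn0 hkn (hω n hn0)
        · exact measure_exp_le_ratioCoeff hK _ n hk _
    _ = ENNReal.ofReal ε + ENNReal.ofReal δ * B + ENNReal.ofReal δ⁻¹ *
          (n * K / ENNReal.ofReal (Real.exp (ε * n / (2 * k))) +
            ∫⁻ ω, ρ {z | ‖ratioCoeff (fun i => ξ i ω) n k z‖ ≤ Real.exp (-(ε * n))} ∂P) := by
        rw [lintegral_add_left measurable_const, lintegral_const, measure_univ, mul_one,
          lintegral_const_mul' _ _ ENNReal.ofReal_ne_top, lintegral_add_left measurable_const,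
          lintegral_const, measure_univ, mul_one]
    _ ≤ ENNReal.ofReal (η / 4) + ENNReal.ofReal (η / 4) + ENNReal.ofReal (η / 2) := by
        gcongr
    _ = ENNReal.ofReal η := by
        rw [← ENNReal.ofReal_add (by positivity) (by positivity),
          ← ENNReal.ofReal_add (by positivity) (by positivity)]
        congr 1
        ring
    _ ≤ η' := hηle

/-! ### Comparison of zeros and conclusion -/

theorem integral_multiset_sum_log (c : ℂ) (r : ℝ) (s : Multiset ℂ) :
    Integrable (fun z => (s.map fun w => Real.log ‖z - w‖).sum) (circleMeasure c r) ∧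
      ∫ z, (s.map fun w => Real.log ‖z - w‖).sum ∂circleMeasure c r =
        (s.map fun w => ∫ z, Real.log ‖z - w‖ ∂circleMeasure c r).sum := by
  induction s using Multiset.induction_on with
  | empty => simp
  | cons a s ih =>
    simp only [Multiset.map_cons, Multiset.sum_cons]
    have h := integrable_log_norm_sub c r a
    exact ⟨h.add ih.1, by rw [integral_add h ih.1, ih.2]⟩

theorem integral_logRatio (x : ℕ → ℂ) {n k : ℕ} (hkn : k ≤ n) (c : ℂ) {r : ℝ} (hr : 0 < r) :
    Integrable (logRatio x n k) (circleMeasure c r) ∧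
    ∫ z, logRatio x n k z ∂circleMeasure c r = (1 / (n : ℝ)) * (Real.log (n.choose k) +
      ((hasseDeriv k (monicWithZeros x n)).roots.map fun w =>
        ∫ z, Real.log ‖z - w‖ ∂circleMeasure c r).sum -
      ∑ i ∈ Finset.range n, ∫ z, Real.log ‖z - x i‖ ∂circleMeasure c r) := by
  obtain ⟨K, hKtop, hK⟩ := exists_lintegral_enorm_sub_rpow_le c hr
  have hae := ae_log_norm_ratioCoeff hKtop hK x hkn
  obtain ⟨h1, h2⟩ := integral_multiset_sum_log c r (hasseDeriv k (monicWithZeros x n)).roots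
  have h3 : Integrable (fun z => ∑ i ∈ Finset.range n, Real.log ‖z - x i‖) (circleMeasure c r) :=
    integrable_finsetSum _ fun i _ => integrable_log_norm_sub c r (x i)
  have h4 : Integrable (fun z => Real.log (n.choose k) +
      ((hasseDeriv k (monicWithZeros x n)).roots.map fun w => Real.log ‖z - w‖).sum)
      (circleMeasure c r) := (integrable_const _).add h1
  refine ⟨((h4.sub h3).congr (hae.mono fun z hz => hz.symm)).const_mul _, ?_⟩
  unfold logRatio
  rw [integral_const_mul, integral_congr_ae hae, integral_sub h4 h3,
    integral_add (integrable_const _) h1, h2, integral_const,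
    integral_finsetSum _ fun i _ => integrable_log_norm_sub c r (x i)]
  simp

/-- Jensen's formula compares the zeros of the `k`-th derivative with those of the polynomial. -/
theorem abs_integral_tent_sub_le (x : ℕ → ℂ) {n k : ℕ} (hkn : k < n) (c : ℂ) {s : ℝ} (hs : 0 < s) :
    |∫ w, tent s (w - c) ∂(zeroMeasure (derivative^[k] (monicWithZeros x n)) : Measure ℂ) -
      (1 / (n : ℝ)) * ∑ i ∈ Finset.range n, tent s (x i - c)| ≤
    ∫ z, |logRatio x n k z| ∂circleMeasure c (2 * s) +
      ∫ z, |logRatio x n k z| ∂circleMeasure c s + k / n * Real.log 2 := by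
  set roots := (hasseDeriv k (monicWithZeros x n)).roots with hroots
  have hcard : Multiset.card roots = n - k := card_roots_hasseDeriv_monicWithZeros x n k
  have hn' : (0 : ℝ) < n := by exact_mod_cast (Nat.zero_le k).trans_lt hkn
  have hnk : (0 : ℝ) < n - k := sub_pos.2 (by exact_mod_cast hkn)
  have hne : roots ≠ 0 := by
    rw [← Multiset.card_pos, hcard]
    omega
  have h2s : 0 < 2 * s := by positivity
  obtain ⟨i1, e1⟩ := integral_logRatio x hkn.le c h2s
  obtain ⟨i2, e2⟩ := integral_logRatio x hkn.le c hs
  set S := (roots.map fun w => tent s (w - c)).sum with hS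
  have hS1 : |S| ≤ (n - k) * Real.log 2 := by
    refine (abs_multiset_sum_map_le _ fun w => norm_tent_le hs (w - c)).trans (le_of_eq ?_)
    rw [Multiset.map_const', Multiset.sum_replicate, hcard, nsmul_eq_mul, Nat.cast_sub hkn.le]
  -- The constant `log (n.choose k)` is the same on both circles and cancels.
  have hdiff : ∫ z, logRatio x n k z ∂circleMeasure c (2 * s) -
      ∫ z, logRatio x n k z ∂circleMeasure c s =
      (1 / (n : ℝ)) * S - (1 / (n : ℝ)) * ∑ i ∈ Finset.range n, tent s (x i - c) := by
    have h1 : S = (roots.map fun w => ∫ z, Real.log ‖z - w‖ ∂circleMeasure c (2 * s)).sum -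
        (roots.map fun w => ∫ z, Real.log ‖z - w‖ ∂circleMeasure c s).sum := by
      rw [← Multiset.sum_map_sub, hS]
      simp_rw [integral_log_norm_sub_sub c hs]
    have h2 : ∑ i ∈ Finset.range n, tent s (x i - c) =
        ∑ i ∈ Finset.range n, ∫ z, Real.log ‖z - x i‖ ∂circleMeasure c (2 * s) -
        ∑ i ∈ Finset.range n, ∫ z, Real.log ‖z - x i‖ ∂circleMeasure c s := by
      rw [← Finset.sum_sub_distrib]
      simp_rw [integral_log_norm_sub_sub c hs]
    rw [e1, e2, h1, h2]
    ring
  rw [zeroMeasure, roots_iterate_derivative, ← hroots,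
    integral_empiricalMeasure hne fun w => tent s (w - c), hcard, Nat.cast_sub hkn.le, ← hS]
  -- The derivative has only `n - k` zeros; passing from weight `1 / n` to `1 / (n - k)` costs `k /
  -- n` times an average of tents, each at most `log 2`.
  have e3 : 1 / ((n : ℝ) - k) * S - 1 / (n : ℝ) * ∑ i ∈ Finset.range n, tent s (x i - c) =
      (∫ z, logRatio x n k z ∂circleMeasure c (2 * s) -
        ∫ z, logRatio x n k z ∂circleMeasure c s) + (k / n) * (1 / ((n : ℝ) - k) * S) := by
    rw [hdiff]
    field_simp
    ring
  have h3 : |(k / n : ℝ) * (1 / ((n : ℝ) - k) * S)| ≤ k / n * Real.log 2 := by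
    rw [abs_mul, abs_of_nonneg (by positivity), abs_mul, abs_of_pos (by positivity)]
    refine mul_le_mul_of_nonneg_left ?_ (by positivity)
    rw [one_div, inv_mul_le_iff₀ hnk]
    exact hS1
  rw [e3]
  refine (abs_add_le _ _).trans (add_le_add ((abs_sub _ _).trans (add_le_add ?_ ?_)) h3)
  · exact abs_integral_le_integral_abs
  · exact abs_integral_le_integral_abs

/-- Almost surely `ξ i` is `a i` or `b i`, so the sum of the two deterministic bounds works for all
`n` at once. -/
theorem ae_cesaro_posLog_le {Ω : Type*} [MeasurableSpace Ω] {P : Measure Ω}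
    {a b : ℕ → ℂ} (ha_log : LogCesaroBounded a) (hb_log : LogCesaroBounded b)
    {ξ : ℕ → Ω → ℂ} (hξ_meas : ∀ i, Measurable (ξ i))
    (hξ_law : ∀ i, P.map (ξ i) =
      (2⁻¹ : ℝ≥0∞) • Measure.dirac (a i) + (2⁻¹ : ℝ≥0∞) • Measure.dirac (b i)) :
    ∃ A : ℝ, ∀ᵐ ω ∂P, ∀ n : ℕ, 1 ≤ n →
      (1 / (n : ℝ)) * ∑ i ∈ Finset.range n, Real.posLog ‖ξ i ω‖ ≤ A := by
  obtain ⟨Ca, hCa⟩ := ha_log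
  obtain ⟨Cb, hCb⟩ := hb_log
  refine ⟨Ca + Cb, ?_⟩
  filter_upwards [ae_all_iff.2 fun i => ae_eq_or_eq (hξ_meas i) (hξ_law i)] with ω hω n hn
  refine le_trans ?_ (add_le_add (hCa n hn) (hCb n hn))
  rw [← mul_add, ← Finset.sum_add_distrib]
  refine mul_le_mul_of_nonneg_left (Finset.sum_le_sum fun i _ => ?_) (by positivity)
  rcases hω i with h | h <;> rw [h]
  · exact le_add_of_nonneg_right Real.posLog_nonneg
  · exact le_add_of_nonneg_left Real.posLog_nonneg

theorem tendsto_measure_integral_logRatio_ge {Ω : Type*} [MeasurableSpace Ω] {P : Measure Ω}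
    [IsProbabilityMeasure P] {a b : ℕ → ℂ} (hab : {i : ℕ | a i ≠ b i}.Infinite)
    (ha_log : LogCesaroBounded a) (hb_log : LogCesaroBounded b)
    {ξ : ℕ → Ω → ℂ} (hξ_meas : ∀ i, Measurable (ξ i)) (hξ_indep : iIndepFun ξ P)
    (hξ_law : ∀ i, P.map (ξ i) =
      (2⁻¹ : ℝ≥0∞) • Measure.dirac (a i) + (2⁻¹ : ℝ≥0∞) • Measure.dirac (b i))
    {k : ℕ} (hk : 1 ≤ k) (c : ℂ) {r : ℝ} (hr : 0 < r) {ε : ℝ} (hε : 0 < ε) :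
    Tendsto (fun n : ℕ =>
      P {ω | ε ≤ ∫ z, |logRatio (fun i => ξ i ω) n k z| ∂circleMeasure c r}) atTop (𝓝 0) := by
  obtain ⟨A, hA⟩ := ae_cesaro_posLog_le ha_log hb_log hξ_meas hξ_law
  obtain ⟨K, hKtop, hK⟩ := exists_lintegral_enorm_sub_rpow_le c hr
  have h1 := tendsto_lintegral_logRatio hab hξ_meas hξ_indep hξ_law hKtop hK
    (ae_norm_le_circleMeasure c r) hA hk
  have h2 := ENNReal.Tendsto.div_const (b := ENNReal.ofReal ε) h1
    (Or.inr (ENNReal.ofReal_pos.2 hε).ne')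
  rw [ENNReal.zero_div] at h2
  refine tendsto_of_tendsto_of_tendsto_of_le_of_le' tendsto_const_nhds h2
    (Eventually.of_forall fun _ => zero_le) ?_
  filter_upwards [eventually_ge_atTop k] with n hkn
  have hm : Measurable fun ω =>
      ∫⁻ z, ENNReal.ofReal |logRatio (fun i => ξ i ω) n k z| ∂circleMeasure c r := by
    refine Measurable.lintegral_prod_right' (f := fun p : Ω × ℂ =>
      ENNReal.ofReal |logRatio (fun i => ξ i p.1) n k p.2|) ?_
    unfold logRatio
    exact (((Real.measurable_log.comp (measurable_uncurry_ratioCoeff hξ_meas n k).norm).const_mul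
      _).abs).ennreal_ofReal
  refine le_trans (measure_mono fun ω hω => ?_) (meas_ge_le_lintegral_div hm.aemeasurable
    (ENNReal.ofReal_pos.2 hε).ne' ENNReal.ofReal_ne_top)
  have hi := (integral_logRatio (fun i => ξ i ω) hkn c hr).1.abs
  change ENNReal.ofReal ε ≤ _
  rw [← ofReal_integral_eq_lintegral_ofReal hi (ae_of_all _ fun z => abs_nonneg _)]
  exact ENNReal.ofReal_le_ofReal hω

theorem tendstoInProbability_derivative {Ω : Type*} [MeasurableSpace Ω] {P : Measure Ω}
    [IsProbabilityMeasure P] {μ : ProbabilityMeasure ℂ} {a b : ℕ → ℂ}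
    (ha : IsDistributed μ a) (hb : IsDistributed μ b)
    (ha_log : LogCesaroBounded a) (hb_log : LogCesaroBounded b)
    (hab : {i : ℕ | a i ≠ b i}.Infinite)
    {ξ : ℕ → Ω → ℂ} (hξ_meas : ∀ i, Measurable (ξ i)) (hξ_indep : iIndepFun ξ P)
    (hξ_law : ∀ i, P.map (ξ i) =
      (2⁻¹ : ℝ≥0∞) • Measure.dirac (a i) + (2⁻¹ : ℝ≥0∞) • Measure.dirac (b i))
    {k : ℕ} (hk : 1 ≤ k) :
    TendstoInProbability P
      (fun n ω => zeroMeasure (derivative^[k] (monicWithZeros (fun i => ξ i ω) n))) μ := by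
  refine tendstoInProbability_of_tent fun c s hs ε hε => ?_
  have hcont : Continuous fun w => tent s (w - c) :=
    (continuous_tent hs).comp (continuous_sub_right c)
  -- One quarter each for the law of large numbers, the two circle integrals and the term `k / n *
  -- log 2`.
  have hε4 : 0 < ε / 4 := by positivity
  have h1 : Tendsto (fun n : ℕ => P {ω | ε / 4 ≤
      |(1 / (n : ℝ)) * ∑ i ∈ Finset.range n, tent s (ξ i ω - c) -
        ∫ w, tent s (w - c) ∂(μ : Measure ℂ)|}) atTop (𝓝 0) := by
    have hm : ∀ n : ℕ, Measurable fun ω =>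
        (1 / (n : ℝ)) * ∑ i ∈ Finset.range n, tent s (ξ i ω - c) := fun n =>
      (Finset.measurable_sum _ fun i _ => hcont.measurable.comp (hξ_meas i)).const_mul _
    have hae := ae_tendsto_average (M := Real.log 2) ha hb hξ_meas hξ_indep hξ_law hcont
      fun w => ⟨tent_nonneg hs _, tent_le hs _⟩
    exact tendstoInMeasure_iff_norm.1 (tendstoInMeasure_of_tendsto_ae
      (fun n => (hm n).aestronglyMeasurable) hae) (ε / 4) hε4
  have h2 := tendsto_measure_integral_logRatio_ge hab ha_log hb_log hξ_meas hξ_indep hξ_law hk c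
    (show 0 < 2 * s by positivity) hε4
  have h3 := tendsto_measure_integral_logRatio_ge hab ha_log hb_log hξ_meas hξ_indep hξ_law hk c
    hs hε4
  have h4 : Tendsto (fun n : ℕ => k / (n : ℝ) * Real.log 2) atTop (𝓝 0) := by
    simpa using (tendsto_const_div_atTop_nhds_zero_nat (k : ℝ)).mul_const (Real.log 2)
  have h5 := (h1.add h2).add h3
  rw [add_zero, add_zero] at h5
  refine tendsto_of_tendsto_of_tendsto_of_le_of_le' tendsto_const_nhds h5
    (Eventually.of_forall fun _ => zero_le) ?_
  filter_upwards [h4.eventually_lt_const hε4, eventually_gt_atTop k] with n hn hkn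
  refine (measure_mono fun ω hω => ?_).trans ((measure_union_le _ _).trans
    (add_le_add (measure_union_le _ _) le_rfl))
  by_contra hcon
  simp only [Set.mem_union, Set.mem_ofPred_eq, not_or, not_le] at hcon
  obtain ⟨⟨g1, g2⟩, g3⟩ := hcon
  have g4 := abs_integral_tent_sub_le (fun i => ξ i ω) hkn c hs
  have hω' : ε ≤ _ := hω
  have g5 := abs_sub_le
    (∫ w, tent s (w - c)
      ∂(zeroMeasure (derivative^[k] (monicWithZeros (fun i => ξ i ω) n)) : Measure ℂ))
    ((1 / (n : ℝ)) * ∑ i ∈ Finset.range n, tent s (ξ i ω - c))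
    (∫ w, tent s (w - c) ∂(μ : Measure ℂ))
  linarith

theorem theorem1p2 {Ω : Type*} [MeasurableSpace Ω] (P : Measure Ω) [IsProbabilityMeasure P]
    (μ : ProbabilityMeasure ℂ) (a b : ℕ → ℂ)
    (ha : IsDistributed μ a) (hb : IsDistributed μ b)
    (ha_log : LogCesaroBounded a) (hb_log : LogCesaroBounded b)
    (hab : {i : ℕ | a i ≠ b i}.Infinite)
    (ξ : ℕ → Ω → ℂ) (hξ_meas : ∀ i, Measurable (ξ i)) (hξ_indep : iIndepFun ξ P)
    (hξ_law : ∀ i, P.map (ξ i) =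
      (2⁻¹ : ℝ≥0∞) • Measure.dirac (a i) + (2⁻¹ : ℝ≥0∞) • Measure.dirac (b i)) :
    (∀ᵐ ω ∂P, Tendsto (fun n : ℕ => zeroMeasure (monicWithZeros (fun i => ξ i ω) n))
      atTop (𝓝 μ)) ∧
    ∀ k : ℕ, 1 ≤ k →
      TendstoInProbability P
        (fun n ω => zeroMeasure (derivative^[k] (monicWithZeros (fun i => ξ i ω) n))) μ := by
  exact ⟨ae_tendsto_zeroMeasure ha hb hξ_meas hξ_indep hξ_law, fun k hk =>
    tendstoInProbability_derivative ha hb ha_log hb_log hab hξ_meas hξ_indep hξ_law hk⟩
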